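/- Let $k$ be a field. A \emph{tri-associative algebra} is a $k$-vector space $A$ with three bilinear operations $\vdash,\dashv,\perp$ such that for all $x,y,z\in A$ \[ \begin{gathered} (x\dashv y)\vdash z=(x\perp y)\vdash z=(x\vdash y)\vdash z=x\vdash(y\vdash z),\\ x\dashv(y\vdash z)=x\dashv(y\perp z)=x\dashv(y\dashv z)=(x\dashv y)\dashv z,\\ (x\vdash y)\dashv z=x\vdash(y\dashv z),\quad (x\perp y)\dashv z=x\perp(y\dashv z),\quad (x\dashv y)\perp z=x\perp(y\vdash z),\\ (x\vdash y)\perp z=x\vdash(y\perp z),\quad (x\perp y)\perp z=x\perp(y\perp z). \end{gathered} \] A \emph{tri-Lie algebra} is a $k$-vector space $L$ with three bilinear operations $[\cdot\vdash\cdot]$, $[\cdot\dashv\cdot]$, $[\cdot\perp\cdot]$ such that $[a\vdash b]=-[b\dashv a]$, the operation $[\cdot\perp\cdot]$ is a Lie bracket (in particular $[a\perp a]=0$), and \[ \begin{gathered} [[x\dashv y]\dashv z]=[[x\dashv z]\dashv y]+[x\dashv[y\dashv z]],\qquad [x\dashv[y\perp z]]=[x\dashv[y\dashv z]],\\ [x\perp[y\dashv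 z]]=[[x\perp y]\dashv z]+[y\perp[x\dashv z]]. \end{gathered} \] Every tri-associative algebra $A$ gives a tri-Lie algebra $A^{(\mathrm{id}\otimes -)}$ on the same space, with $[a\vdash b]=a\vdash b-b\dashv a$, $[a\dashv b]=a\dashv b-b\vdash a$, $[a\perp b]=a\perp b-b\perp a$. For a tri-Lie algebra $L$, the \emph{universal enveloping tri-associative algebra} $U_{\mathrm{id}\otimes -}(L)$ is a tri-associative algebra with a homomorphism of tri-Lie algebras $\iota:L\to U_{\mathrm{id}\otimes -}(L)^{(\mathrm{id}\otimes -)}$ such that for every tri-associative algebra $A$ and every homomorphism $\psi:L\to A^{(\mathrm{id}\otimes -)}$ there is a unique homomorphism $\xi:U_{\mathrm{id}\otimes -}(L)\to A$ of tri-associative algebras with $\xi\circ\iota=\psi$. Let $L_0\subseteq L$ be the linear span of all differences $[a * b]-[a *' b]$ with $a,b\in L$ and $*,*'\in\{\vdash,\dashv,\perp\}$; it is an ideal, and $\bar L=L/L_0$ is a Lie algebra under the bracket induced by any of the three operations. Let $L_\perp$ be the Lie algebra $(L,[\cdot\perp\cdot])$. For a Lie algebra $\mathfrak g$, let $U(\mathfrak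 g)$ be its universal enveloping associative algebra with identity and let $U_0(\mathfrak g)$ be the augmentation ideal of $U(\mathfrak g)$. \textbf{Corollary (PBW for tri-Lie algebras).} For every tri-Lie algebra $L$ over $k$, the algebra $U_{\mathrm{id}\otimes -}(L)$ exists and is isomorphic, as a $k$-vector space, to $U(\bar L)\otimes_k U_0(L_\perp)$. -/

import Mathlib

universe u v w

namespace TriPBW

/-- The three replicated copies of a binary operation, indexed by the nonempty sets of
emphasized arguments: `vdash` emphasizes the second argument, `dashv` the first one and
`perp` both. -/
inductive TriOp
  | vdash
  | dashv
  | perp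

/-- A linear space with three bilinear operations `⊢`, `⊣`, `⊥`. -/
class TriAlgebra (k : Type u) (A : Type v) [CommRing k] [AddCommGroup A] [Module k A] where
  op : TriOp → A →ₗ[k] A →ₗ[k] A

section Ops

variable (k : Type u) {A : Type v} [CommRing k] [AddCommGroup A] [Module k A] [TriAlgebra k A]

/-- `a ⊢ b` -/
abbrev vd (a b : A) : A := TriAlgebra.op (k := k) TriOp.vdash a b

/-- `a ⊣ b` -/
abbrev dv (a b : A) : A := TriAlgebra.op (k := k) TriOp.dashv a b

/-- `a ⊥ b` -/
abbrev pp (a b : A) : A := TriAlgebra.op (k := k) TriOp.perp a b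

end Ops

/-- Homomorphisms: linear maps that respect the three operations. -/
def IsTriHom {k : Type u} {A : Type v} {B : Type w} [CommRing k]
    [AddCommGroup A] [Module k A] [TriAlgebra k A]
    [AddCommGroup B] [Module k B] [TriAlgebra k B] (f : A →ₗ[k] B) : Prop :=
  ∀ (s : TriOp) (a b : A),
    f (TriAlgebra.op (k := k) s a b) = TriAlgebra.op (k := k) s (f a) (f b)

/-- Triassociative algebras (tri-As): the identities obtained from `(xy)z = x(yz)` by emphasizing
any nonempty set of variables, and the identities saying that in a non-emphasized argument
the three operations are interchangeable. -/
class IsTriAs (k : Type u) (A : Type v) [CommRing k] [AddCommGroup A] [Module k A]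
    [TriAlgebra k A] : Prop where
  vd_dv : ∀ x y z : A, vd k (dv k x y) z = vd k (vd k x y) z
  vd_pp : ∀ x y z : A, vd k (pp k x y) z = vd k (vd k x y) z
  dv_vd : ∀ x y z : A, dv k x (vd k y z) = dv k x (dv k y z)
  dv_pp : ∀ x y z : A, dv k x (pp k y z) = dv k x (dv k y z)
  assoc₁ : ∀ x y z : A, dv k (dv k x y) z = dv k x (dv k y z)
  assoc₂ : ∀ x y z : A, dv k (vd k x y) z = vd k x (dv k y z)
  assoc₃ : ∀ x y z : A, vd k (vd k x y) z = vd k x (vd k y z)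
  assoc₁₂ : ∀ x y z : A, dv k (pp k x y) z = pp k x (dv k y z)
  assoc₁₃ : ∀ x y z : A, pp k (dv k x y) z = pp k x (vd k y z)
  assoc₂₃ : ∀ x y z : A, pp k (vd k x y) z = vd k x (pp k y z)
  assoc₁₂₃ : ∀ x y z : A, pp k (pp k x y) z = pp k x (pp k y z)

/-- tri-Lie algebras: `[a ⊢ b] = -[b ⊣ a]`, the operation `[· ⊥ ·]` is a Lie bracket,
`[· ⊣ ·]` satisfies the right Leibniz identity, every `[· ⊣ x₃]` is a derivation of `[· ⊥ ·]`
(the Jacobi identity `[x₁,[x₂,x₃]] = [[x₁,x₂],x₃] + [x₂,[x₁,x₃]]` with `x₁`, `x₂` emphasized), and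
`[x₁ ⊣ [x₂ ⊥ x₃]] = [x₁ ⊣ [x₂ ⊣ x₃]]`. -/
class IsTriLie (k : Type u) (L : Type v) [CommRing k] [AddCommGroup L] [Module k L]
    [TriAlgebra k L] : Prop where
  vd_eq : ∀ a b : L, vd k a b = - dv k b a
  pp_self : ∀ a : L, pp k a a = 0
  pp_jacobi : ∀ x y z : L, pp k x (pp k y z) = pp k (pp k x y) z + pp k y (pp k x z)
  dv_leibniz : ∀ x y z : L, dv k (dv k x y) z = dv k (dv k x z) y + dv k x (dv k y z)
  pp_dv : ∀ x y z : L, pp k x (dv k y z) = dv k (pp k x y) z + pp k y (dv k x z)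
  dv_pp : ∀ x y z : L, dv k x (pp k y z) = dv k x (dv k y z)

section Quotient

variable {k : Type u} {A : Type v} [CommRing k] [AddCommGroup A] [Module k A] [TriAlgebra k A]

/-- Two-sided ideals for all three operations. -/
def IsTriIdeal (I : Submodule k A) : Prop :=
  ∀ (s : TriOp) (a b : A), a ∈ I →
    TriAlgebra.op (k := k) s a b ∈ I ∧ TriAlgebra.op (k := k) s b a ∈ I

/-- The operations induced on the quotient by an ideal. -/
def quotOp (I : Submodule k A) (hI : IsTriIdeal I) (s : TriOp) :
    (A ⧸ I) →ₗ[k] (A ⧸ I) →ₗ[k] (A ⧸ I) :=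
  I.liftQ
    (LinearMap.flip
      (I.liftQ (((TriAlgebra.op (k := k) (A := A) s).compr₂ I.mkQ).flip) (by
        intro b hb
        rw [LinearMap.mem_ker]
        ext a
        simpa using (hI s b a hb).2)))
    (by
      intro a ha
      rw [LinearMap.mem_ker]
      ext b
      simpa using (hI s a b ha).1)

theorem quotOp_mk (I : Submodule k A) (hI : IsTriIdeal I) (s : TriOp) (a b : A) :
    quotOp I hI s (I.mkQ a) (I.mkQ b) = I.mkQ (TriAlgebra.op (k := k) s a b) := rfl

end Quotient

/-! ### The tri-Lie algebra of a tri-associative algebra -/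

/-- The linear space `A` with the operations `[a ⊢ b] = a ⊢ b - b ⊣ a`,
`[a ⊣ b] = a ⊣ b - b ⊢ a`, `[a ⊥ b] = a ⊥ b - b ⊥ a`. -/
def Minus (k : Type u) (A : Type v) [CommRing k] [AddCommGroup A] [Module k A]
    [TriAlgebra k A] : Type v := A

section Minus

variable (k : Type u) (A : Type v) [CommRing k] [AddCommGroup A] [Module k A] [TriAlgebra k A]

instance : AddCommGroup (Minus k A) := inferInstanceAs (AddCommGroup A)

instance : Module k (Minus k A) := inferInstanceAs (Module k A)

/-- The identity map, as a linear equivalence. -/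
def toMinus : A ≃ₗ[k] Minus k A := LinearEquiv.refl k A

/-- The three commutators. -/
def minusOp : TriOp → A →ₗ[k] A →ₗ[k] A
  | TriOp.vdash => TriAlgebra.op TriOp.vdash - (TriAlgebra.op TriOp.dashv).flip
  | TriOp.dashv => TriAlgebra.op TriOp.dashv - (TriAlgebra.op TriOp.vdash).flip
  | TriOp.perp => TriAlgebra.op TriOp.perp - (TriAlgebra.op TriOp.perp).flip

instance : TriAlgebra k (Minus k A) where
  op := minusOp k A

/-- The commutators of a tri-associative algebra form a tri-Lie algebra. -/
instance [IsTriAs k A] : IsTriLie k (Minus k A) where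
  vd_eq a b := by
    change vd k (A := A) a b - dv k (A := A) b a = -(dv k (A := A) b a - vd k (A := A) a b)
    abel
  pp_self a := by
    change pp k (A := A) a a - pp k (A := A) a a = 0
    abel
  pp_jacobi x y z := by
    have h := IsTriAs.assoc₁₂₃ (k := k) (A := A)
    revert x y z
    change ∀ x y z : A, pp k (A := A) x (pp k (A := A) y z - pp k (A := A) z y)
        - pp k (A := A) (pp k (A := A) y z - pp k (A := A) z y) x
      = (pp k (A := A) (pp k (A := A) x y - pp k (A := A) y x) z
        - pp k (A := A) z (pp k (A := A) x y - pp k (A := A) y x))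
      + (pp k (A := A) y (pp k (A := A) x z - pp k (A := A) z x)
        - pp k (A := A) (pp k (A := A) x z - pp k (A := A) z x) y)
    intro x y z
    simp only [pp, map_sub, LinearMap.sub_apply] at h ⊢
    simp only [h]
    abel
  dv_leibniz x y z := by
    have h1 := IsTriAs.assoc₁ (k := k) (A := A)
    have h2 := IsTriAs.assoc₂ (k := k) (A := A)
    have h3 := IsTriAs.assoc₃ (k := k) (A := A)
    have h4 := IsTriAs.vd_dv (k := k) (A := A)
    have h5 := IsTriAs.dv_vd (k := k) (A := A)
    revert x y z
    change ∀ x y z : A, (dv k (A := A) (dv k (A := A) x y - vd k (A := A) y x) z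
        - vd k (A := A) z (dv k (A := A) x y - vd k (A := A) y x))
      = (dv k (A := A) (dv k (A := A) x z - vd k (A := A) z x) y
        - vd k (A := A) y (dv k (A := A) x z - vd k (A := A) z x))
      + (dv k (A := A) x (dv k (A := A) y z - vd k (A := A) z y)
        - vd k (A := A) (dv k (A := A) y z - vd k (A := A) z y) x)
    intro x y z
    simp only [dv, vd, map_sub, LinearMap.sub_apply] at h1 h2 h3 h4 h5 ⊢
    simp only [h5, h4, h1, h2, h3]
    abel
  pp_dv x y z := by
    have h1 := IsTriAs.assoc₁₂ (k := k) (A := A)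
    have h2 := IsTriAs.assoc₁₃ (k := k) (A := A)
    have h3 := IsTriAs.assoc₂₃ (k := k) (A := A)
    revert x y z
    change ∀ x y z : A, (pp k (A := A) x (dv k (A := A) y z - vd k (A := A) z y)
        - pp k (A := A) (dv k (A := A) y z - vd k (A := A) z y) x)
      = (dv k (A := A) (pp k (A := A) x y - pp k (A := A) y x) z
        - vd k (A := A) z (pp k (A := A) x y - pp k (A := A) y x))
      + (pp k (A := A) y (dv k (A := A) x z - vd k (A := A) z x)
        - pp k (A := A) (dv k (A := A) x z - vd k (A := A) z x) y)
    intro x y z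
    simp only [dv, vd, pp, map_sub, LinearMap.sub_apply] at h1 h2 h3 ⊢
    simp only [h1, h2, h3]
    abel
  dv_pp x y z := by
    have h1 := IsTriAs.dv_pp (k := k) (A := A)
    have h2 := IsTriAs.dv_vd (k := k) (A := A)
    have h3 := IsTriAs.vd_pp (k := k) (A := A)
    have h4 := IsTriAs.vd_dv (k := k) (A := A)
    revert x y z
    change ∀ x y z : A, (dv k (A := A) x (pp k (A := A) y z - pp k (A := A) z y)
        - vd k (A := A) (pp k (A := A) y z - pp k (A := A) z y) x)
      = (dv k (A := A) x (dv k (A := A) y z - vd k (A := A) z y)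
        - vd k (A := A) (dv k (A := A) y z - vd k (A := A) z y) x)
    intro x y z
    simp only [dv, vd, pp, map_sub, LinearMap.sub_apply] at h1 h2 h3 h4 ⊢
    simp only [h1, h2, h3, h4]

end Minus

/-! ### The universal enveloping tri-associative algebra -/

/-- `U` together with `ι : L → U` is a universal enveloping tri-associative algebra of `L`. -/
structure IsTriEnvelope (k : Type u) (L : Type v) [Field k] [AddCommGroup L] [Module k L]
    [TriAlgebra k L] (U : Type (max u v)) [AddCommGroup U] [Module k U] [TriAlgebra k U]
    (ι : L →ₗ[k] Minus k U) : Prop where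
  isTriAs : IsTriAs k U
  isTriHom : IsTriHom ι
  existsUnique_lift : ∀ (A : Type w) [AddCommGroup A] [Module k A] [TriAlgebra k A] [IsTriAs k A]
    (ψ : L →ₗ[k] Minus k A), IsTriHom ψ →
    ∃! ξ : U →ₗ[k] A, IsTriHom ξ ∧
      ∀ x : L, ξ ((toMinus k U).symm (ι x)) = (toMinus k A).symm (ψ x)

/-- Nonassociative monomials in three binary operations. -/
inductive Tree (X : Type v) : Type v
  | of : X → Tree X
  | node : TriOp → Tree X → Tree X → Tree X

/-- The free algebra with three bilinear operations: linear combinations of monomials. -/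
abbrev FreeTri (k : Type u) (X : Type v) [CommRing k] : Type (max u v) := Tree X →₀ k

section Envelope

variable (k : Type u) (L : Type v)

noncomputable instance [CommRing k] : TriAlgebra k (FreeTri k L) where
  op s := Finsupp.lift _ k _ fun p => Finsupp.lift _ k _ fun q =>
    Finsupp.single (Tree.node s p q) 1

theorem free_op_single [CommRing k] (s : TriOp) (p q : Tree L) :
    TriAlgebra.op (k := k) s (Finsupp.single p (1 : k)) (Finsupp.single q (1 : k))
      = Finsupp.single (Tree.node s p q) (1 : k) := by
  simp [TriAlgebra.op]

/-- A generator of the free algebra. -/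
noncomputable abbrev gen [CommRing k] {L : Type v} (a : L) : FreeTri k L :=
  Finsupp.single (Tree.of a) 1

variable [CommRing k] [AddCommGroup L] [Module k L] [TriAlgebra k L]

/-- The relations of the enveloping algebra: the identities of tri-associative algebras, linearity
of the generators, and the three commutator relations. -/
inductive UERel : FreeTri k L → FreeTri k L → Prop
  | vd_dv (x y z) : UERel (vd k (dv k x y) z) (vd k (vd k x y) z)
  | vd_pp (x y z) : UERel (vd k (pp k x y) z) (vd k (vd k x y) z)
  | dv_vd (x y z) : UERel (dv k x (vd k y z)) (dv k x (dv k y z))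
  | dv_pp (x y z) : UERel (dv k x (pp k y z)) (dv k x (dv k y z))
  | assoc₁ (x y z) : UERel (dv k (dv k x y) z) (dv k x (dv k y z))
  | assoc₂ (x y z) : UERel (dv k (vd k x y) z) (vd k x (dv k y z))
  | assoc₃ (x y z) : UERel (vd k (vd k x y) z) (vd k x (vd k y z))
  | assoc₁₂ (x y z) : UERel (dv k (pp k x y) z) (pp k x (dv k y z))
  | assoc₁₃ (x y z) : UERel (pp k (dv k x y) z) (pp k x (vd k y z))
  | assoc₂₃ (x y z) : UERel (pp k (vd k x y) z) (vd k x (pp k y z))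
  | assoc₁₂₃ (x y z) : UERel (pp k (pp k x y) z) (pp k x (pp k y z))
  | gen_add (a b : L) : UERel (gen k (a + b)) (gen k a + gen k b)
  | gen_smul (c : k) (a : L) : UERel (gen k (c • a)) (c • gen k a)
  | bracket_vd (a b : L) :
      UERel (gen k (vd k a b)) (vd k (gen k a) (gen k b) - dv k (gen k b) (gen k a))
  | bracket_dv (a b : L) :
      UERel (gen k (dv k a b)) (dv k (gen k a) (gen k b) - vd k (gen k b) (gen k a))
  | bracket_pp (a b : L) :
      UERel (gen k (pp k a b)) (pp k (gen k a) (gen k b) - pp k (gen k b) (gen k a))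

/-- The ideal generated by the relations. -/
noncomputable def ueIdeal : Submodule k (FreeTri k L) :=
  sInf {I | IsTriIdeal I ∧ ∀ p q, UERel k L p q → p - q ∈ I}

theorem ueIdeal_isTriIdeal : IsTriIdeal (ueIdeal k L) := by
  intro s a b ha
  simp only [ueIdeal, Submodule.mem_sInf] at ha ⊢
  exact ⟨fun I hI => (hI.1 s a b (ha I hI)).1, fun I hI => (hI.1 s a b (ha I hI)).2⟩

/-- The universal enveloping tri-associative algebra of a tri-Lie algebra. -/
def TriUEA : Type (max u v) := FreeTri k L ⧸ ueIdeal k L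

noncomputable instance : AddCommGroup (TriUEA k L) :=
  inferInstanceAs (AddCommGroup (FreeTri k L ⧸ ueIdeal k L))

noncomputable instance : Module k (TriUEA k L) :=
  inferInstanceAs (Module k (FreeTri k L ⧸ ueIdeal k L))

noncomputable instance : TriAlgebra k (TriUEA k L) where
  op := quotOp (ueIdeal k L) (ueIdeal_isTriIdeal k L)

/-- The projection of the free algebra. -/
noncomputable def TriUEA.mk : FreeTri k L →ₗ[k] TriUEA k L := (ueIdeal k L).mkQ

theorem TriUEA.mk_surjective : Function.Surjective (TriUEA.mk k L) :=
  (ueIdeal k L).mkQ_surjective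

theorem TriUEA.mk_op (s : TriOp) (a b : FreeTri k L) :
    TriAlgebra.op (k := k) s (TriUEA.mk k L a) (TriUEA.mk k L b)
      = TriUEA.mk k L (TriAlgebra.op (k := k) s a b) := rfl

theorem TriUEA.mk_eq {p q : FreeTri k L} (h : UERel k L p q) :
    TriUEA.mk k L p = TriUEA.mk k L q := by
  refine (Submodule.Quotient.eq (ueIdeal k L)).2 ?_
  simp only [ueIdeal, Submodule.mem_sInf]
  exact fun I hI => hI.2 p q h

instance : IsTriAs k (TriUEA k L) := by
  have key : ∀ (P : TriUEA k L → TriUEA k L → TriUEA k L → Prop),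
      (∀ x y z, P (TriUEA.mk k L x) (TriUEA.mk k L y) (TriUEA.mk k L z)) → ∀ x y z, P x y z := by
    intro P h x y z
    obtain ⟨x, rfl⟩ := TriUEA.mk_surjective k L x
    obtain ⟨y, rfl⟩ := TriUEA.mk_surjective k L y
    obtain ⟨z, rfl⟩ := TriUEA.mk_surjective k L z
    exact h x y z
  constructor <;> refine key _ fun x y z => ?_ <;>
    simp only [vd, dv, pp, TriUEA.mk_op] <;> apply TriUEA.mk_eq
  · exact UERel.vd_dv x y z
  · exact UERel.vd_pp x y z
  · exact UERel.dv_vd x y z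
  · exact UERel.dv_pp x y z
  · exact UERel.assoc₁ x y z
  · exact UERel.assoc₂ x y z
  · exact UERel.assoc₃ x y z
  · exact UERel.assoc₁₂ x y z
  · exact UERel.assoc₁₃ x y z
  · exact UERel.assoc₂₃ x y z
  · exact UERel.assoc₁₂₃ x y z

/-- The canonical map of `L` to its enveloping algebra. -/
noncomputable def TriUEA.ι : L →ₗ[k] Minus k (TriUEA k L) where
  toFun a := toMinus k (TriUEA k L) (TriUEA.mk k L (gen k a))
  map_add' a b := by
    rw [TriUEA.mk_eq k L (UERel.gen_add a b), map_add, map_add]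
  map_smul' c a := by
    rw [TriUEA.mk_eq k L (UERel.gen_smul c a), map_smul, map_smul, RingHom.id_apply]

theorem TriUEA.ι_isTriHom : IsTriHom (TriUEA.ι k L) := by
  rintro (_ | _ | _) a b
  · exact TriUEA.mk_eq k L (UERel.bracket_vd a b)
  · exact TriUEA.mk_eq k L (UERel.bracket_dv a b)
  · exact TriUEA.mk_eq k L (UERel.bracket_pp a b)

end Envelope

section Universal

variable {k : Type u} {L : Type v} [CommRing k]

/-- Evaluation of monomials. -/
def Tree.eval (k : Type u) [CommRing k] {A : Type w} [AddCommGroup A] [Module k A]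
    [TriAlgebra k A] (f : L → A) : Tree L → A
  | Tree.of a => f a
  | Tree.node s p q => TriAlgebra.op (k := k) s (Tree.eval k f p) (Tree.eval k f q)

/-- Evaluation of elements of the free algebra. -/
noncomputable def freeLift {A : Type w} [AddCommGroup A] [Module k A] [TriAlgebra k A]
    (f : L → A) : FreeTri k L →ₗ[k] A :=
  Finsupp.lift A k (Tree L) (Tree.eval k f)

theorem freeLift_single {A : Type w} [AddCommGroup A] [Module k A] [TriAlgebra k A]
    (f : L → A) (p : Tree L) : freeLift (k := k) f (Finsupp.single p 1) = Tree.eval k f p := by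
  simp [freeLift]

theorem freeLift_isTriHom {A : Type w} [AddCommGroup A] [Module k A] [TriAlgebra k A]
    (f : L → A) : IsTriHom (freeLift (k := k) f) := by
  intro s a b
  have h : (TriAlgebra.op (k := k) (A := FreeTri k L) s).compr₂ (freeLift f)
      = (TriAlgebra.op (k := k) (A := A) s).compl₁₂ (freeLift f) (freeLift f) := by
    ext p q
    simp only [LinearMap.compr₂_apply, LinearMap.compl₁₂_apply, LinearMap.coe_comp,
      Function.comp_apply, Finsupp.lsingle_apply, free_op_single, freeLift_single, Tree.eval]
  exact LinearMap.congr_fun₂ h a b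

variable [AddCommGroup L] [Module k L] [TriAlgebra k L]

theorem TriUEA.existsUnique_lift (A : Type w) [AddCommGroup A] [Module k A] [TriAlgebra k A]
    [IsTriAs k A] (ψ : L →ₗ[k] Minus k A) (hψ : IsTriHom ψ) :
    ∃! ξ : TriUEA k L →ₗ[k] A, IsTriHom ξ ∧
      ∀ x : L, ξ ((toMinus k (TriUEA k L)).symm (TriUEA.ι k L x)) = (toMinus k A).symm (ψ x) := by
  set f : L → A := fun a => (toMinus k A).symm (ψ a) with hf
  have hom := freeLift_isTriHom (k := k) f
  have hgen : ∀ a, freeLift (k := k) f (gen k a) = f a := fun a => freeLift_single f (Tree.of a)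
  have hker : ueIdeal k L ≤ LinearMap.ker (freeLift (k := k) f) := by
    refine sInf_le ⟨?_, ?_⟩
    · intro s a b ha
      rw [LinearMap.mem_ker] at ha
      constructor <;> rw [LinearMap.mem_ker, hom, ha] <;> simp
    · intro p q h
      rw [LinearMap.mem_ker, map_sub, sub_eq_zero]
      have hvd := hom TriOp.vdash
      have hdv := hom TriOp.dashv
      have hpp := hom TriOp.perp
      cases h with
      | vd_dv x y z => simpa only [vd, dv, pp, hvd, hdv, hpp] using IsTriAs.vd_dv (k := k) _ _ _
      | vd_pp x y z => simpa only [vd, dv, pp, hvd, hdv, hpp] using IsTriAs.vd_pp (k := k) _ _ _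
      | dv_vd x y z => simpa only [vd, dv, pp, hvd, hdv, hpp] using IsTriAs.dv_vd (k := k) _ _ _
      | dv_pp x y z => simpa only [vd, dv, pp, hvd, hdv, hpp] using IsTriAs.dv_pp (k := k) _ _ _
      | assoc₁ x y z => simpa only [vd, dv, pp, hvd, hdv, hpp] using IsTriAs.assoc₁ (k := k) _ _ _
      | assoc₂ x y z => simpa only [vd, dv, pp, hvd, hdv, hpp] using IsTriAs.assoc₂ (k := k) _ _ _
      | assoc₃ x y z => simpa only [vd, dv, pp, hvd, hdv, hpp] using IsTriAs.assoc₃ (k := k) _ _ _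
      | assoc₁₂ x y z => simpa only [vd, dv, pp, hvd, hdv, hpp] using IsTriAs.assoc₁₂ (k := k) _ _ _
      | assoc₁₃ x y z => simpa only [vd, dv, pp, hvd, hdv, hpp] using IsTriAs.assoc₁₃ (k := k) _ _ _
      | assoc₂₃ x y z => simpa only [vd, dv, pp, hvd, hdv, hpp] using IsTriAs.assoc₂₃ (k := k) _ _ _
      | assoc₁₂₃ x y z =>
        simpa only [vd, dv, pp, hvd, hdv, hpp] using IsTriAs.assoc₁₂₃ (k := k) _ _ _
      | gen_add a b => rw [map_add, hgen, hgen, hgen]; simp [hf]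
      | gen_smul c a => rw [map_smul, hgen, hgen]; simp [hf]
      | bracket_vd a b =>
        rw [map_sub, vd, dv, hvd, hdv, hgen, hgen, hgen]; exact hψ TriOp.vdash a b
      | bracket_dv a b =>
        rw [map_sub, vd, dv, hvd, hdv, hgen, hgen, hgen]; exact hψ TriOp.dashv a b
      | bracket_pp a b =>
        rw [map_sub, pp, pp, hpp, hpp, hgen, hgen, hgen]; exact hψ TriOp.perp a b
  refine ⟨(ueIdeal k L).liftQ (freeLift f) hker, ⟨?_, ?_⟩, ?_⟩
  · intro s a b
    obtain ⟨a, rfl⟩ := TriUEA.mk_surjective k L a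
    obtain ⟨b, rfl⟩ := TriUEA.mk_surjective k L b
    exact hom s a b
  · exact hgen
  · rintro ξ ⟨hξ, hξι⟩
    have h : ξ ∘ₗ TriUEA.mk k L = freeLift f := by
      ext p
      simp only [LinearMap.coe_comp, Function.comp_apply, Finsupp.lsingle_apply, freeLift_single]
      induction p with
      | of a => exact hξι a
      | node s p q hp hq =>
        rw [← free_op_single, ← TriUEA.mk_op, hξ, hp, hq, Tree.eval]
    ext x
    obtain ⟨x, rfl⟩ := TriUEA.mk_surjective k L x
    exact LinearMap.congr_fun h x

end Universal

theorem TriUEA.isTriEnvelope (k : Type u) (L : Type v) [Field k] [AddCommGroup L] [Module k L]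
    [TriAlgebra k L] : IsTriEnvelope.{u, v, w} k L (TriUEA k L) (TriUEA.ι k L) where
  isTriAs := inferInstance
  isTriHom := TriUEA.ι_isTriHom k L
  existsUnique_lift A _ _ _ _ ψ hψ := TriUEA.existsUnique_lift A ψ hψ

/-! ### The Lie algebras `L̄ = L / L₀` and `L_⊥` -/

section LieAlgebras

variable (k : Type u) (L : Type v) [CommRing k] [AddCommGroup L] [Module k L] [TriAlgebra k L]

/-- `L₀`: the linear span of all differences of two of the three products of the same elements. -/
def L0 : Submodule k L :=
  Submodule.span k {x | ∃ (s t : TriOp) (a b : L),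
    x = TriAlgebra.op (k := k) s a b - TriAlgebra.op (k := k) t a b}

theorem op_sub_op_mem_L0 (s t : TriOp) (a b : L) :
    TriAlgebra.op (k := k) s a b - TriAlgebra.op (k := k) t a b ∈ L0 k L :=
  Submodule.subset_span ⟨s, t, a, b, rfl⟩

theorem dv_op_eq [IsTriLie k L] (s : TriOp) (a b c : L) :
    dv k c (TriAlgebra.op (k := k) s a b) = dv k c (dv k a b) := by
  cases s with
  | vdash =>
    have h : pp k a b = - pp k b a := by
      have h := IsTriLie.pp_self (k := k) (a + b)
      simp only [pp, map_add, LinearMap.add_apply] at h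
      have ha := IsTriLie.pp_self (k := k) a
      have hb := IsTriLie.pp_self (k := k) b
      simp only [pp] at ha hb ⊢
      rw [ha, hb, zero_add, add_zero] at h
      exact eq_neg_of_add_eq_zero_right h
    change dv k c (vd k a b) = _
    rw [IsTriLie.vd_eq, ← IsTriLie.dv_pp, h]
    simp only [dv, pp, map_neg]
    rw [neg_inj]
    exact (IsTriLie.dv_pp c b a).symm
  | dashv => rfl
  | perp => exact IsTriLie.dv_pp c a b

theorem L0_isTriIdeal [IsTriLie k L] : IsTriIdeal (L0 k L) := by
  have h0 : ∀ a ∈ L0 k L, ∀ b : L, dv k b a = 0 := by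
    intro a ha b
    refine (Submodule.span_le (p := LinearMap.ker (TriAlgebra.op (k := k) TriOp.dashv b))).2 ?_ ha
    rintro x ⟨s, t, a, c, rfl⟩
    rw [SetLike.mem_coe, LinearMap.mem_ker, map_sub, sub_eq_zero]
    exact (dv_op_eq k L s a c b).trans (dv_op_eq k L t a c b).symm
  intro s a b ha
  constructor
  · have h := op_sub_op_mem_L0 k L s TriOp.vdash a b
    have hv : vd k a b = 0 := by rw [IsTriLie.vd_eq, h0 a ha b, neg_zero]
    change TriAlgebra.op (k := k) s a b - vd k a b ∈ L0 k L at h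
    rwa [hv, sub_zero] at h
  · have h := op_sub_op_mem_L0 k L s TriOp.dashv b a
    change TriAlgebra.op (k := k) s b a - dv k b a ∈ L0 k L at h
    rwa [h0 a ha b, sub_zero] at h

/-- `L̄ = L / L₀` -/
def LBar : Type v := L ⧸ L0 k L

instance : AddCommGroup (LBar k L) := inferInstanceAs (AddCommGroup (L ⧸ L0 k L))

instance : Module k (LBar k L) := inferInstanceAs (Module k (L ⧸ L0 k L))

/-- The projection `L → L̄`. -/
def LBar.mk : L →ₗ[k] LBar k L := (L0 k L).mkQ

theorem LBar.mk_surjective : Function.Surjective (LBar.mk k L) := (L0 k L).mkQ_surjective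

/-- The linear space `L` with the bracket `[· ⊥ ·]`. -/
def LPerp (k : Type u) (L : Type v) [CommRing k] [AddCommGroup L] [Module k L]
    [TriAlgebra k L] : Type v := L

instance : AddCommGroup (LPerp k L) := inferInstanceAs (AddCommGroup L)

instance : Module k (LPerp k L) := inferInstanceAs (Module k L)

variable [IsTriLie k L]

/-- The bracket of `L̄` is induced by any of the three operations of `L`. -/
instance : Bracket (LBar k L) (LBar k L) where
  bracket x y := quotOp (L0 k L) (L0_isTriIdeal k L) TriOp.perp x y

theorem LBar.bracket_mk (s : TriOp) (a b : L) :
    ⁅LBar.mk k L a, LBar.mk k L b⁆ = LBar.mk k L (TriAlgebra.op (k := k) s a b) :=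
  (Submodule.Quotient.eq (L0 k L)).2 (op_sub_op_mem_L0 k L TriOp.perp s a b)

instance : LieRing (LBar k L) where
  add_lie x y z := LinearMap.map_add₂ (quotOp (L0 k L) (L0_isTriIdeal k L) TriOp.perp) x y z
  lie_add x y z := map_add (quotOp (L0 k L) (L0_isTriIdeal k L) TriOp.perp x) y z
  lie_self x := by
    obtain ⟨x, rfl⟩ := LBar.mk_surjective k L x
    rw [LBar.bracket_mk k L TriOp.perp]
    exact (congrArg (LBar.mk k L) (IsTriLie.pp_self (k := k) x)).trans (map_zero _)
  leibniz_lie x y z := by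
    obtain ⟨x, rfl⟩ := LBar.mk_surjective k L x
    obtain ⟨y, rfl⟩ := LBar.mk_surjective k L y
    obtain ⟨z, rfl⟩ := LBar.mk_surjective k L z
    simp only [LBar.bracket_mk k L TriOp.perp]
    rw [← map_add]
    exact congrArg (LBar.mk k L) (IsTriLie.pp_jacobi (k := k) x y z)

instance : LieAlgebra k (LBar k L) where
  lie_smul c x y := map_smul (quotOp (L0 k L) (L0_isTriIdeal k L) TriOp.perp x) c y

instance : LieRing (LPerp k L) where
  bracket x y := pp k (A := L) x y
  add_lie x y z := LinearMap.map_add₂ (TriAlgebra.op (k := k) (A := L) TriOp.perp) x y z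
  lie_add x y z := map_add (TriAlgebra.op (k := k) (A := L) TriOp.perp x) y z
  lie_self x := IsTriLie.pp_self (k := k) (L := L) x
  leibniz_lie x y z := IsTriLie.pp_jacobi (k := k) (L := L) x y z

instance : LieAlgebra k (LPerp k L) where
  lie_smul c x y := map_smul (TriAlgebra.op (k := k) (A := L) TriOp.perp x) c y

end LieAlgebras

section Augmentation

attribute [local instance] LieRing.ofAssociativeRing

/-- The augmentation `U(𝔤) → k`, the algebra homomorphism that vanishes on `𝔤`. -/
noncomputable def augmentation (k : Type u) (𝔤 : Type v) [CommRing k] [LieRing 𝔤]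
    [LieAlgebra k 𝔤] : UniversalEnvelopingAlgebra k 𝔤 →ₐ[k] k :=
  UniversalEnvelopingAlgebra.lift k (0 : 𝔤 →ₗ⁅k⁆ k)

/-- The augmentation ideal `U₀(𝔤)` of `U(𝔤)`, as a linear space. -/
noncomputable def augIdeal (k : Type u) (𝔤 : Type v) [CommRing k] [LieRing 𝔤]
    [LieAlgebra k 𝔤] : Submodule k (UniversalEnvelopingAlgebra k 𝔤) :=
  LinearMap.ker (augmentation k 𝔤).toLinearMap

end Augmentation

end TriPBW

/-! The enveloping algebra is realized inside an ordinary enveloping algebra. The Lie algebra `L̄`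
acts on `L_⊥` by the derivations `x ↦ [z ⊢ x]`, so the semidirect sum `L_⊥ ⋊ L̄` and `R = U(L_⊥ ⋊
L̄)` are available. There are two algebra maps `R → U(L̄)` split by the inclusion `U(L̄) → R`: the
projection (`SemiSum.proj`), which kills `L_⊥`, and the retraction (`SemiSum.retract`), which sends
`(x, y)` to `x̄ + y`. The retraction followed by the inclusion is an idempotent endomorphism `e` of
`R`, and `e(a) b`, `a e(b)`, `a b` are tri-associative operations on `R` (`twisted_isTriAs`). For
them `x ↦ (x, 0)` is a homomorphism of tri-Lie algebras, which gives `F : TriUEA k L → R`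
(`exists_isSemiSumHom`).

The map `F` is an isomorphism onto the kernel of the projection. For the image: it is a right ideal,
it contains `L_⊥`, it is stable under left multiplication by `L̄`, and it lies in the kernel
(`IsSemiSumHom.range_eq`). For injectivity: once the claim is known, `R` is the direct sum of the
image of `F` and `U(L̄)`, so its left regular module should be `TriUEA k L × U(L̄)`. This module is
constructed in advance by explicit formulas (`TriUEA.semiAction`), and `F a` sends `(0, 1)`, which
plays the role of the unit, to `(a, 0)`.

Finally `U(𝔥 ⋊ 𝔤)` is `U(𝔥) ⊗ U(𝔤)` as a linear space (`UEA.semiDirectEquiv`), and the projection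
becomes augmentation on the first factor. Its kernel is therefore `U₀(L_⊥) ⊗ U(L̄)`. No bases are
chosen anywhere. -/

namespace TriPBW

open TensorProduct LieAlgebra

/-! ### Enveloping algebras: induction, functoriality, extension of derivations -/

section EnvelopingAlgebra

attribute [local instance 100] LieRing.ofAssociativeRing

local notation "𝒰" => UniversalEnvelopingAlgebra

variable {k : Type u} [CommRing k] {𝔤 : Type v} [LieRing 𝔤] [LieAlgebra k 𝔤]

/-- The elements with the property form a subalgebra containing the generators. By the universal
property `ι` lifts into it, and by uniqueness the lift is a section of the inclusion, so the
subalgebra is everything. -/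
theorem UEA.induction {P : 𝒰 k 𝔤 → Prop} (algebraMap : ∀ c : k, P (algebraMap k _ c))
    (ι : ∀ x : 𝔤, P (UniversalEnvelopingAlgebra.ι k x))
    (add : ∀ a b, P a → P b → P (a + b)) (mul : ∀ a b, P a → P b → P (a * b)) (a : 𝒰 k 𝔤) :
    P a := by
  let S : Subalgebra k (𝒰 k 𝔤) :=
    { carrier := {a | P a}
      mul_mem' := fun ha hb => mul _ _ ha hb
      add_mem' := fun ha hb => add _ _ ha hb
      algebraMap_mem' := algebraMap }
  let f : 𝔤 →ₗ⁅k⁆ S :=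
    { toFun := fun x => ⟨UniversalEnvelopingAlgebra.ι k x, ι x⟩
      map_add' := fun x y => Subtype.ext (map_add (UniversalEnvelopingAlgebra.ι k) x y)
      map_smul' := fun c x => Subtype.ext (map_smul (UniversalEnvelopingAlgebra.ι k) c x)
      map_lie' := fun {x y} => Subtype.ext (LieHom.map_lie (UniversalEnvelopingAlgebra.ι k) x y) }
  have h : S.val.comp (UniversalEnvelopingAlgebra.lift k f) = AlgHom.id k _ := by
    apply UniversalEnvelopingAlgebra.hom_ext
    ext x
    change (UniversalEnvelopingAlgebra.lift k f (UniversalEnvelopingAlgebra.ι k x) : 𝒰 k 𝔤) =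
      UniversalEnvelopingAlgebra.ι k x
    rw [UniversalEnvelopingAlgebra.lift_ι_apply]
    rfl
  rw [← AlgHom.id_apply (R := k) a, ← h]
  exact (UniversalEnvelopingAlgebra.lift k f a).2

/-- Induction over products of generators, extended on the left. -/
theorem UEA.induction_left (N : Submodule k (𝒰 k 𝔤)) (one : 1 ∈ N)
    (mul : ∀ (x : 𝔤), ∀ a ∈ N, UniversalEnvelopingAlgebra.ι k x * a ∈ N) (a : 𝒰 k 𝔤) : a ∈ N := by
  suffices h : ∀ a : 𝒰 k 𝔤, ∀ b ∈ N, a * b ∈ N by simpa using h a 1 one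
  intro a
  induction a using UEA.induction with
  | algebraMap c => intro b hb; rw [← Algebra.smul_def]; exact N.smul_mem c hb
  | ι x => exact mul x
  | add a b ha hb => intro c hc; rw [add_mul]; exact N.add_mem (ha c hc) (hb c hc)
  | mul a b ha hb => intro c hc; rw [mul_assoc]; exact ha _ (hb c hc)

theorem UEA.ι_lie (x y : 𝔤) : UniversalEnvelopingAlgebra.ι k ⁅x, y⁆ =
    UniversalEnvelopingAlgebra.ι k x * UniversalEnvelopingAlgebra.ι k y
      - UniversalEnvelopingAlgebra.ι k y * UniversalEnvelopingAlgebra.ι k x := by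
  rw [LieHom.map_lie, LieRing.of_associative_ring_bracket]

/-- Functoriality of the enveloping algebra. -/
noncomputable def UEA.map {𝔥 : Type w} [LieRing 𝔥] [LieAlgebra k 𝔥] (f : 𝔤 →ₗ⁅k⁆ 𝔥) :
    𝒰 k 𝔤 →ₐ[k] 𝒰 k 𝔥 :=
  UniversalEnvelopingAlgebra.lift k ((UniversalEnvelopingAlgebra.ι k).comp f)

theorem UEA.map_ι {𝔥 : Type w} [LieRing 𝔥] [LieAlgebra k 𝔥] (f : 𝔤 →ₗ⁅k⁆ 𝔥) (x : 𝔤) :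
    UEA.map f (UniversalEnvelopingAlgebra.ι k x) = UniversalEnvelopingAlgebra.ι k (f x) :=
  UniversalEnvelopingAlgebra.lift_ι_apply k _ x

/-- The algebra homomorphism `a ↦ a + D a ε` of a derivation `D` of a Lie algebra. -/
noncomputable def UEA.dualNumberLift (d : LieDerivation k 𝔤 𝔤) :
    𝒰 k 𝔤 →ₐ[k] DualNumber (𝒰 k 𝔤) :=
  UniversalEnvelopingAlgebra.lift k
    { toFun := fun x => TrivSqZeroExt.inl (UniversalEnvelopingAlgebra.ι k x)
        + TrivSqZeroExt.inr (UniversalEnvelopingAlgebra.ι k (d x))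
      map_add' := fun x y => by
        ext <;> simp
      map_smul' := fun c x => by
        ext <;> simp
      map_lie' := fun {x y} => by
        rw [LieRing.of_associative_ring_bracket, LieDerivation.apply_lie_eq_add]
        ext
        · simp only [TrivSqZeroExt.fst_add, TrivSqZeroExt.fst_sub, TrivSqZeroExt.fst_mul,
            TrivSqZeroExt.fst_inl, TrivSqZeroExt.fst_inr, add_zero, UEA.ι_lie]
        · simp only [TrivSqZeroExt.snd_add, TrivSqZeroExt.snd_sub, TrivSqZeroExt.snd_mul,
            TrivSqZeroExt.fst_add, TrivSqZeroExt.fst_inl, TrivSqZeroExt.fst_inr, add_zero,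
            TrivSqZeroExt.snd_inl, TrivSqZeroExt.snd_inr, zero_add, UEA.ι_lie, map_add,
            smul_eq_mul, MulOpposite.smul_eq_mul_unop, MulOpposite.unop_op]
          abel }

theorem UEA.fst_dualNumberLift (d : LieDerivation k 𝔤 𝔤) (a : 𝒰 k 𝔤) :
    (UEA.dualNumberLift d a).fst = a := by
  have h : (TrivSqZeroExt.fstHom k (𝒰 k 𝔤) (𝒰 k 𝔤)).comp (UEA.dualNumberLift d)
      = AlgHom.id k _ := by
    apply UniversalEnvelopingAlgebra.hom_ext
    ext x
    change (UEA.dualNumberLift d (UniversalEnvelopingAlgebra.ι k x)).fst = _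
    rw [UEA.dualNumberLift, UniversalEnvelopingAlgebra.lift_ι_apply]
    change UniversalEnvelopingAlgebra.ι k x + 0 = UniversalEnvelopingAlgebra.ι k x
    rw [add_zero]
  exact DFunLike.congr_fun h a

/-- The extension of a derivation of a Lie algebra to its enveloping algebra. -/
noncomputable def UEA.der (d : LieDerivation k 𝔤 𝔤) : Module.End k (𝒰 k 𝔤) :=
  (TrivSqZeroExt.sndHom (𝒰 k 𝔤) (𝒰 k 𝔤)).restrictScalars k ∘ₗ (UEA.dualNumberLift d).toLinearMap

theorem UEA.der_ι (d : LieDerivation k 𝔤 𝔤) (x : 𝔤) :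
    UEA.der d (UniversalEnvelopingAlgebra.ι k x) = UniversalEnvelopingAlgebra.ι k (d x) := by
  change (UEA.dualNumberLift d (UniversalEnvelopingAlgebra.ι k x)).snd = _
  rw [UEA.dualNumberLift, UniversalEnvelopingAlgebra.lift_ι_apply]
  change 0 + UniversalEnvelopingAlgebra.ι k (d x) = UniversalEnvelopingAlgebra.ι k (d x)
  rw [zero_add]

/-- This is the `ε`-component of the multiplicativity of `a ↦ a + D a ε`. -/
theorem UEA.der_mul (d : LieDerivation k 𝔤 𝔤) (a b : 𝒰 k 𝔤) :
    UEA.der d (a * b) = a * UEA.der d b + UEA.der d a * b := by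
  change (UEA.dualNumberLift d (a * b)).snd = _
  rw [map_mul, TrivSqZeroExt.snd_mul, UEA.fst_dualNumberLift, UEA.fst_dualNumberLift]
  rfl

theorem UEA.der_algebraMap (d : LieDerivation k 𝔤 𝔤) (c : k) :
    UEA.der d (algebraMap k _ c) = 0 := by
  change (UEA.dualNumberLift d (algebraMap k _ c)).snd = 0
  rw [AlgHom.commutes]
  rfl

theorem UEA.der_one (d : LieDerivation k 𝔤 𝔤) : UEA.der d 1 = 0 := by
  simpa using UEA.der_algebraMap d 1

/-- Linear maps that satisfy the Leibniz rule are determined by their values on generators. -/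
theorem UEA.eq_of_leibniz {f g : Module.End k (𝒰 k 𝔤)}
    (hf : ∀ a b, f (a * b) = a * f b + f a * b) (hg : ∀ a b, g (a * b) = a * g b + g a * b)
    (h : ∀ x, f (UniversalEnvelopingAlgebra.ι k x) = g (UniversalEnvelopingAlgebra.ι k x)) :
    f = g := by
  have one : ∀ f : Module.End k (𝒰 k 𝔤), (∀ a b, f (a * b) = a * f b + f a * b) → f 1 = 0 := by
    intro f hf
    simpa using hf 1 1
  ext a
  induction a using UEA.induction with
  | algebraMap c => rw [Algebra.algebraMap_eq_smul_one, map_smul, map_smul, one f hf, one g hg]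
  | ι x => exact h x
  | add a b ha hb => rw [map_add, map_add, ha, hb]
  | mul a b ha hb => rw [hf, hg, ha, hb]

/-- The action of the derivations of a Lie algebra on its enveloping algebra. -/
noncomputable def UEA.derHom (k : Type u) [CommRing k] (𝔤 : Type v) [LieRing 𝔤]
    [LieAlgebra k 𝔤] : LieDerivation k 𝔤 𝔤 →ₗ⁅k⁆ Module.End k (𝒰 k 𝔤) where
  toFun := UEA.der
  map_add' d d' := by
    refine UEA.eq_of_leibniz (UEA.der_mul _) (fun a b => ?_) fun x => ?_
    · simp only [LinearMap.add_apply, UEA.der_mul, mul_add, add_mul]; abel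
    · simp only [LinearMap.add_apply, UEA.der_ι, LieDerivation.add_apply, map_add]
  map_smul' c d := by
    refine UEA.eq_of_leibniz (UEA.der_mul _) (fun a b => ?_) fun x => ?_
    · simp [UEA.der_mul]
    · simp only [UEA.der_ι, LinearMap.smul_apply, LieDerivation.smul_apply, map_smul,
        RingHom.id_apply]
  map_lie' {d d'} := by
    refine UEA.eq_of_leibniz (UEA.der_mul _) (fun a b => ?_) fun x => ?_
    · simp only [LieRing.of_associative_ring_bracket, LinearMap.sub_apply, Module.End.mul_apply,
        UEA.der_mul, map_add, mul_sub, sub_mul]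
      abel
    · simp only [LieRing.of_associative_ring_bracket, LinearMap.sub_apply, Module.End.mul_apply,
        UEA.der_ι, LieDerivation.commutator_apply, map_sub]

end EnvelopingAlgebra

/-! ### The enveloping algebra of a semidirect sum as a smash product -/

section SemiDirect

attribute [local instance 100] LieRing.ofAssociativeRing

local notation "𝒰" => UniversalEnvelopingAlgebra

variable {k : Type u} [CommRing k] {𝔥 : Type v} [LieRing 𝔥] [LieAlgebra k 𝔥]
  {𝔤 : Type v} [LieRing 𝔤] [LieAlgebra k 𝔤] (ψ : 𝔤 →ₗ⁅k⁆ LieDerivation k 𝔥 𝔥)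

/-- The homomorphism of a semidirect sum that extends two compatible homomorphisms. -/
def semiDirectLift {A : Type w} [LieRing A] [LieAlgebra k A] (β : 𝔥 →ₗ⁅k⁆ A) (α : 𝔤 →ₗ⁅k⁆ A)
    (h : ∀ y x, β (ψ y x) = ⁅α y, β x⁆) : SemiDirectSum 𝔥 𝔤 ψ →ₗ⁅k⁆ A where
  toFun s := β s.left + α s.right
  map_add' s t := by
    simp only [SemiDirectSum.add_eq_mk, map_add]; abel
  map_smul' c s := by
    simp only [SemiDirectSum.smul_eq_mk, map_smul, smul_add, RingHom.id_apply]
  map_lie' {s t} := by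
    simp only [SemiDirectSum.lie_eq_mk, map_add, map_sub, LieHom.map_lie, h, lie_add, add_lie]
    rw [← lie_skew (β s.left) (α t.right)]
    abel

theorem semiDirectLift_inl {A : Type w} [LieRing A] [LieAlgebra k A] (β : 𝔥 →ₗ⁅k⁆ A)
    (α : 𝔤 →ₗ⁅k⁆ A) (h : ∀ y x, β (ψ y x) = ⁅α y, β x⁆) (x : 𝔥) :
    semiDirectLift ψ β α h (SemiDirectSum.inl ψ x) = β x := by
  change β x + α 0 = β x
  rw [map_zero, add_zero]

theorem semiDirectLift_inr {A : Type w} [LieRing A] [LieAlgebra k A] (β : 𝔥 →ₗ⁅k⁆ A)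
    (α : 𝔤 →ₗ⁅k⁆ A) (h : ∀ y x, β (ψ y x) = ⁅α y, β x⁆) (y : 𝔤) :
    semiDirectLift ψ β α h (SemiDirectSum.inr ψ y) = α y := by
  change β 0 + α y = α y
  rw [map_zero, zero_add]

theorem SemiDirectSum.eq_inl_add_inr (s : SemiDirectSum 𝔥 𝔤 ψ) :
    s = SemiDirectSum.inl ψ s.left + SemiDirectSum.inr ψ s.right := by
  simp

theorem SemiDirectSum.inl_apply_eq_lie (y : 𝔤) (x : 𝔥) :
    SemiDirectSum.inl ψ (ψ y x) = ⁅SemiDirectSum.inr ψ y, SemiDirectSum.inl ψ x⁆ := by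
  simp

/-- Induction over products of elements of the two summands, extended on the left. -/
theorem UEA.semiDirect_induction_left (N : Submodule k (𝒰 k (SemiDirectSum 𝔥 𝔤 ψ))) (one : 1 ∈ N)
    (inl : ∀ x, ∀ a ∈ N, UniversalEnvelopingAlgebra.ι k (SemiDirectSum.inl ψ x) * a ∈ N)
    (inr : ∀ y, ∀ a ∈ N, UniversalEnvelopingAlgebra.ι k (SemiDirectSum.inr ψ y) * a ∈ N)
    (a : 𝒰 k (SemiDirectSum 𝔥 𝔤 ψ)) : a ∈ N := by
  refine UEA.induction_left N one (fun s a ha => ?_) a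
  rw [SemiDirectSum.eq_inl_add_inr ψ s, map_add, add_mul]
  exact N.add_mem (inl _ a ha) (inr _ a ha)

/-- Left multiplication by the elements of a Lie algebra in the enveloping algebra. -/
noncomputable def UEA.mulLeft (k : Type u) [CommRing k] (𝔤 : Type v) [LieRing 𝔤]
    [LieAlgebra k 𝔤] : 𝔤 →ₗ⁅k⁆ Module.End k (𝒰 k 𝔤) :=
  ((Algebra.lmul k (𝒰 k 𝔤) : 𝒰 k 𝔤 →ₐ[k] Module.End k (𝒰 k 𝔤)) :
    𝒰 k 𝔤 →ₗ⁅k⁆ Module.End k (𝒰 k 𝔤)).comp (UniversalEnvelopingAlgebra.ι k)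

theorem UEA.mulLeft_apply (x : 𝔤) (a : 𝒰 k 𝔤) :
    UEA.mulLeft k 𝔤 x a = UniversalEnvelopingAlgebra.ι k x * a := rfl

/-- The action of the semidirect sum on `U(𝔥) ⊗ U(𝔤)`. -/
noncomputable def UEA.semiDirectAction :
    𝒰 k (SemiDirectSum 𝔥 𝔤 ψ) →ₐ[k] Module.End k (𝒰 k 𝔥 ⊗[k] 𝒰 k 𝔤) :=
  UniversalEnvelopingAlgebra.lift k <| semiDirectLift ψ
    { toFun := fun x => (UEA.mulLeft k 𝔥 x).rTensor (𝒰 k 𝔤)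
      map_add' := fun x y => by rw [map_add, LinearMap.rTensor_add]
      map_smul' := fun c x => by rw [map_smul, LinearMap.rTensor_smul, RingHom.id_apply]
      map_lie' := fun {x y} => by
        rw [LieHom.map_lie, LieRing.of_associative_ring_bracket,
          LieRing.of_associative_ring_bracket, LinearMap.rTensor_sub, LinearMap.rTensor_mul,
          LinearMap.rTensor_mul] }
    -- The formula is forced by `y a b = D_y(a) b + a y b` in `U(𝔥 ⋊ 𝔤)`, for `a` from `U(𝔥)` and
    -- `b` from `U(𝔤)`.
    { toFun := fun y => (UEA.derHom k 𝔥 (ψ y)).rTensor (𝒰 k 𝔤)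
        + (UEA.mulLeft k 𝔤 y).lTensor (𝒰 k 𝔥)
      map_add' := fun x y => by
        simp only [map_add, LinearMap.rTensor_add, LinearMap.lTensor_add]; abel
      map_smul' := fun c x => by
        simp only [map_smul, LinearMap.rTensor_smul, LinearMap.lTensor_smul, RingHom.id_apply,
          smul_add]
      map_lie' := fun {x y} => by
        rw [LieHom.map_lie, LieHom.map_lie, LieHom.map_lie]
        simp only [LieRing.of_associative_ring_bracket]
        ext a b
        simp
        abel }
    -- By the Leibniz rule, the commutator of `D_y` with left multiplication by `x` is left
    -- multiplication by `D_y x`; the operators on the second factor cancel.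
    (fun y x => by
      ext a b
      simp only [LieHom.coe_mk, LieRing.of_associative_ring_bracket]
      simp [UEA.mulLeft_apply, UEA.derHom, UEA.der_mul, UEA.der_ι, TensorProduct.add_tmul,
        -UniversalEnvelopingAlgebra.ι_apply])

theorem UEA.semiDirectAction_inl (x : 𝔥) (a : 𝒰 k 𝔥) (b : 𝒰 k 𝔤) :
    UEA.semiDirectAction ψ (UniversalEnvelopingAlgebra.ι k (SemiDirectSum.inl ψ x)) (a ⊗ₜ b)
      = (UniversalEnvelopingAlgebra.ι k x * a) ⊗ₜ b := by
  rw [UEA.semiDirectAction, UniversalEnvelopingAlgebra.lift_ι_apply, semiDirectLift_inl]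
  rfl

theorem UEA.semiDirectAction_inr (y : 𝔤) (a : 𝒰 k 𝔥) (b : 𝒰 k 𝔤) :
    UEA.semiDirectAction ψ (UniversalEnvelopingAlgebra.ι k (SemiDirectSum.inr ψ y)) (a ⊗ₜ b)
      = UEA.der (ψ y) a ⊗ₜ b + a ⊗ₜ (UniversalEnvelopingAlgebra.ι k y * b) := by
  rw [UEA.semiDirectAction, UniversalEnvelopingAlgebra.lift_ι_apply, semiDirectLift_inr]
  rfl

/-- The multiplication map `U(𝔥) ⊗ U(𝔤) → U(𝔥 ⋊ 𝔤)`. -/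
noncomputable def UEA.mulMap : 𝒰 k 𝔥 ⊗[k] 𝒰 k 𝔤 →ₗ[k] 𝒰 k (SemiDirectSum 𝔥 𝔤 ψ) :=
  LinearMap.mul' k _ ∘ₗ TensorProduct.map (UEA.map (SemiDirectSum.inl ψ)).toLinearMap
    (UEA.map (SemiDirectSum.inr ψ)).toLinearMap

theorem UEA.mulMap_tmul (a : 𝒰 k 𝔥) (b : 𝒰 k 𝔤) : UEA.mulMap ψ (a ⊗ₜ b)
    = UEA.map (SemiDirectSum.inl ψ) a * UEA.map (SemiDirectSum.inr ψ) b := rfl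

/-- The derivation becomes inner in the larger algebra: both sides obey the Leibniz rule in `a` and
agree on `𝔥` by the definition of the semidirect bracket. -/
theorem UEA.map_inl_der (y : 𝔤) (a : 𝒰 k 𝔥) :
    UEA.map (SemiDirectSum.inl ψ) (UEA.der (ψ y) a) =
      UniversalEnvelopingAlgebra.ι k (SemiDirectSum.inr ψ y) * UEA.map (SemiDirectSum.inl ψ) a
      - UEA.map (SemiDirectSum.inl ψ) a
        * UniversalEnvelopingAlgebra.ι k (SemiDirectSum.inr ψ y) := by
  induction a using UEA.induction with
  | algebraMap c => rw [UEA.der_algebraMap, map_zero, AlgHom.commutes, Algebra.commutes, sub_self]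
  | ι x => rw [UEA.der_ι, UEA.map_ι, UEA.map_ι, SemiDirectSum.inl_apply_eq_lie, UEA.ι_lie]
  | add a b ha hb => rw [map_add, map_add, ha, hb, map_add, mul_add, add_mul]; abel
  | mul a b ha hb =>
    rw [UEA.der_mul, map_add, map_mul, map_mul, map_mul, ha, hb]
    noncomm_ring

/-- The multiplication map is linear over `U(𝔥 ⋊ 𝔤)`, which only needs checking on the two summands.
For `𝔥` this is associativity, for `𝔤` the commutation rule `UEA.map_inl_der`. At `t = 1 ⊗ 1` it
gives surjectivity. -/
theorem UEA.mulMap_semiDirectAction (u : 𝒰 k (SemiDirectSum 𝔥 𝔤 ψ)) (t : 𝒰 k 𝔥 ⊗[k] 𝒰 k 𝔤) :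
    UEA.mulMap ψ (UEA.semiDirectAction ψ u t) = u * UEA.mulMap ψ t := by
  let N : Submodule k (𝒰 k (SemiDirectSum 𝔥 𝔤 ψ)) :=
    { carrier := {u | ∀ t, UEA.mulMap ψ (UEA.semiDirectAction ψ u t) = u * UEA.mulMap ψ t}
      zero_mem' := fun t => by simp
      add_mem' := fun {a b} ha hb t => by
        rw [map_add, LinearMap.add_apply, map_add, ha, hb, add_mul]
      smul_mem' := fun c a ha t => by
        rw [map_smul, LinearMap.smul_apply, map_smul, ha, smul_mul_assoc] }
  refine UEA.semiDirect_induction_left ψ N ?_ ?_ ?_ u t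
  · intro t
    rw [map_one, one_mul, Module.End.one_apply]
  · intro x u hu t
    rw [map_mul, Module.End.mul_apply, mul_assoc, ← hu]
    induction UEA.semiDirectAction ψ u t with
    | zero => simp
    | add s t hs ht => simp only [map_add, hs, ht, mul_add]
    | tmul a b =>
      rw [UEA.semiDirectAction_inl, UEA.mulMap_tmul, UEA.mulMap_tmul, map_mul, UEA.map_ι, mul_assoc]
  · intro y u hu t
    rw [map_mul, Module.End.mul_apply, mul_assoc, ← hu]
    induction UEA.semiDirectAction ψ u t with
    | zero => simp
    | add s t hs ht => simp only [map_add, hs, ht, mul_add]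
    | tmul a b =>
      rw [UEA.semiDirectAction_inr, map_add, UEA.mulMap_tmul, UEA.mulMap_tmul, UEA.mulMap_tmul,
        UEA.map_inl_der, map_mul, UEA.map_ι]
      noncomm_ring

/-- Acting on `1 ⊗ 1`, the `U(𝔤)` part fills the second factor and then the `U(𝔥)` part multiplies
into the first. Hence the multiplication map is injective. -/
theorem UEA.semiDirectAction_mulMap (t : 𝒰 k 𝔥 ⊗[k] 𝒰 k 𝔤) :
    UEA.semiDirectAction ψ (UEA.mulMap ψ t) (1 ⊗ₜ 1) = t := by
  have hl : ∀ a c : 𝒰 k 𝔥, ∀ b : 𝒰 k 𝔤,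
      UEA.semiDirectAction ψ (UEA.map (SemiDirectSum.inl ψ) a) (c ⊗ₜ b) = (a * c) ⊗ₜ b := by
    intro a
    induction a using UEA.induction with
    | algebraMap r =>
      intro c b
      rw [AlgHom.commutes, AlgHom.commutes, Module.algebraMap_end_apply, ← Algebra.smul_def,
        TensorProduct.smul_tmul']
    | ι x => intro c b; rw [UEA.map_ι, UEA.semiDirectAction_inl]
    | add a a' ha ha' =>
      intro c b
      rw [map_add, map_add, LinearMap.add_apply, ha, ha', add_mul, TensorProduct.add_tmul]
    | mul a a' ha ha' =>
      intro c b
      rw [map_mul, map_mul, Module.End.mul_apply, ha', ha, mul_assoc]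
  -- The first factor must be `1` here: derivations kill it, so only left multiplication on the
  -- second factor survives.
  have hr : ∀ b c : 𝒰 k 𝔤,
      UEA.semiDirectAction ψ (UEA.map (SemiDirectSum.inr ψ) b) (1 ⊗ₜ c) = 1 ⊗ₜ (b * c) := by
    intro b
    induction b using UEA.induction with
    | algebraMap r =>
      intro c
      rw [AlgHom.commutes, AlgHom.commutes, Module.algebraMap_end_apply, ← Algebra.smul_def,
        TensorProduct.tmul_smul]
    | ι x =>
      intro c
      rw [UEA.map_ι, UEA.semiDirectAction_inr, UEA.der_one, TensorProduct.zero_tmul, zero_add]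
    | add a a' ha ha' =>
      intro c
      rw [map_add, map_add, LinearMap.add_apply, ha, ha', add_mul, TensorProduct.tmul_add]
    | mul a a' ha ha' =>
      intro c
      rw [map_mul, map_mul, Module.End.mul_apply, ha', ha, mul_assoc]
  induction t with
  | zero => simp
  | add s t hs ht => rw [map_add, map_add, LinearMap.add_apply, hs, ht]
  | tmul a b => rw [UEA.mulMap_tmul, map_mul, Module.End.mul_apply, hr, hl, mul_one, mul_one]

/-- `U(𝔥 ⋊ 𝔤)` is a smash product of `U(𝔥)` and `U(𝔤)`. -/
noncomputable def UEA.semiDirectEquiv :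
    𝒰 k 𝔥 ⊗[k] 𝒰 k 𝔤 ≃ₗ[k] 𝒰 k (SemiDirectSum 𝔥 𝔤 ψ) :=
  LinearEquiv.ofLinearMap (UEA.mulMap ψ)
    -- The inverse is the orbit map of `1 ⊗ 1`.
    (LinearMap.applyₗ (1 ⊗ₜ 1) ∘ₗ (UEA.semiDirectAction ψ).toLinearMap)
    (by
      ext u
      change UEA.mulMap ψ (UEA.semiDirectAction ψ u (1 ⊗ₜ 1)) = u
      rw [UEA.mulMap_semiDirectAction, UEA.mulMap_tmul, map_one, map_one, mul_one, mul_one])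
    (LinearMap.ext fun t => UEA.semiDirectAction_mulMap ψ t)

/-- The projection kills `𝔥` and is the identity on `𝔤`, so it is augmentation on the factor `U(𝔥)`
and the identity on `U(𝔤)`. -/
theorem UEA.map_projr_mulMap (t : 𝒰 k 𝔥 ⊗[k] 𝒰 k 𝔤) :
    UEA.map (SemiDirectSum.projr ψ) (UEA.mulMap ψ t) =
      TensorProduct.lid k _ ((augmentation k 𝔥).toLinearMap.rTensor (𝒰 k 𝔤) t) := by
  have hl : ∀ a, UEA.map (SemiDirectSum.projr ψ) (UEA.map (SemiDirectSum.inl ψ) a)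
      = algebraMap k _ (augmentation k 𝔥 a) := by
    intro a
    induction a using UEA.induction with
    | algebraMap r => simp only [AlgHom.commutes, Algebra.algebraMap_self, RingHom.id_apply]
    | ι x =>
      rw [UEA.map_ι, UEA.map_ι, augmentation, UniversalEnvelopingAlgebra.lift_ι_apply,
        SemiDirectSum.projr_inl_apply, map_zero, LieHom.zero_apply, map_zero]
    | add a b ha hb => simp only [map_add, ha, hb]
    | mul a b ha hb => simp only [map_mul, ha, hb]
  have hr : ∀ b, UEA.map (SemiDirectSum.projr ψ) (UEA.map (SemiDirectSum.inr ψ) b) = b := by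
    intro b
    induction b using UEA.induction with
    | algebraMap r => simp only [AlgHom.commutes]
    | ι x => rw [UEA.map_ι, UEA.map_ι, SemiDirectSum.projr_inr_apply]
    | add a b ha hb => simp only [map_add, ha, hb]
    | mul a b ha hb => simp only [map_mul, ha, hb]
  induction t with
  | zero => simp
  | add s t hs ht => simp only [map_add, hs, ht]
  | tmul a b =>
    rw [UEA.mulMap_tmul, map_mul, hl, hr, LinearMap.rTensor_tmul, TensorProduct.lid_tmul,
      AlgHom.toLinearMap_apply, Algebra.smul_def]

/-- The kernel of `U(𝔥 ⋊ 𝔤) → U(𝔤)` is `U₀(𝔥) ⊗ U(𝔤)`. -/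
theorem UEA.nonempty_ker_map_projr_equiv {k : Type u} [Field k] {𝔥 : Type v} [LieRing 𝔥]
    [LieAlgebra k 𝔥] {𝔤 : Type v} [LieRing 𝔤] [LieAlgebra k 𝔤]
    (ψ : 𝔤 →ₗ⁅k⁆ LieDerivation k 𝔥 𝔥) :
    Nonempty (LinearMap.ker (UEA.map (SemiDirectSum.projr ψ)).toLinearMap
      ≃ₗ[k] augIdeal k 𝔥 ⊗[k] 𝒰 k 𝔤) := by
  let f : augIdeal k 𝔥 ⊗[k] 𝒰 k 𝔤 →ₗ[k] 𝒰 k (SemiDirectSum 𝔥 𝔤 ψ) :=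
    (UEA.semiDirectEquiv ψ).toLinearMap ∘ₗ (augIdeal k 𝔥).subtype.rTensor (𝒰 k 𝔤)
  have hf : Function.Injective f :=
    (UEA.semiDirectEquiv ψ).injective.comp
      (Module.Flat.rTensor_preserves_injective_linearMap _ (augIdeal k 𝔥).injective_subtype)
  -- Right exactness of the tensor product identifies the kernel of augmentation tensored with the
  -- identity with the image of `U₀(𝔥) ⊗ U(𝔤)`; flatness, used in `hf`, makes the latter embed.
  have hex : Function.Exact ((augIdeal k 𝔥).subtype.rTensor (𝒰 k 𝔤))
      ((augmentation k 𝔥).toLinearMap.rTensor (𝒰 k 𝔤)) :=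
    rTensor_exact _ (LinearMap.exact_subtype_ker_map _)
      fun c => ⟨algebraMap k _ c, (augmentation k 𝔥).commutes c⟩
  have hrange : LinearMap.range f = LinearMap.ker (UEA.map (SemiDirectSum.projr ψ)).toLinearMap := by
    ext u
    obtain ⟨t, rfl⟩ := (UEA.semiDirectEquiv ψ).surjective u
    have h1 : UEA.semiDirectEquiv ψ t ∈ LinearMap.range f ↔
        t ∈ Set.range ((augIdeal k 𝔥).subtype.rTensor (𝒰 k 𝔤)) := by
      constructor
      · rintro ⟨s, hs⟩
        exact ⟨s, (UEA.semiDirectEquiv ψ).injective hs⟩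
      · rintro ⟨s, rfl⟩
        exact ⟨s, rfl⟩
    rw [h1, ← hex t, LinearMap.mem_ker, AlgHom.toLinearMap_apply]
    change _ ↔ UEA.map (SemiDirectSum.projr ψ) (UEA.mulMap ψ t) = 0
    rw [UEA.map_projr_mulMap, LinearEquiv.map_eq_zero_iff]
  exact ⟨(LinearEquiv.ofEq _ _ hrange).symm ≪≫ₗ (LinearEquiv.ofInjective f hf).symm⟩

end SemiDirect

/-! ### Tri-associative algebras from idempotent endomorphisms -/

section TwistedTriAlgebra

variable {k : Type u} {R : Type v} [CommRing k] [Ring R] [Algebra k R]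

/-- The linear space of an algebra `R`, with the operations `e(a) b`, `a e(b)`, `a b` given by an
endomorphism `e` of `R`. -/
def Twisted (_ : R →ₐ[k] R) : Type v := R

instance (e : R →ₐ[k] R) : AddCommGroup (Twisted e) := inferInstanceAs (AddCommGroup R)

instance (e : R →ₐ[k] R) : Module k (Twisted e) := inferInstanceAs (Module k R)

/-- The operations of `Twisted e`. -/
def twistedOp (e : R →ₐ[k] R) : TriOp → R →ₗ[k] R →ₗ[k] R
  | TriOp.vdash => (LinearMap.mul k R).comp e.toLinearMap
  | TriOp.dashv => (LinearMap.mul k R).compl₂ e.toLinearMap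
  | TriOp.perp => LinearMap.mul k R

instance (e : R →ₐ[k] R) : TriAlgebra k (Twisted e) where
  op := twistedOp (R := R) e

/-- A non-emphasized factor enters only through its image under `e`. Since `e` is multiplicative and
idempotent, all three products of `a` and `b` have the same image `e(a) e(b)`; everything else is
associativity in `R`. -/
theorem twisted_isTriAs (e : R →ₐ[k] R) (he : ∀ a, e (e a) = e a) : IsTriAs k (Twisted e) where
  vd_dv := by
    change ∀ x y z : R, e (x * e y) * z = e (e x * y) * z
    simp [he, mul_assoc]
  vd_pp := by
    change ∀ x y z : R, e (x * y) * z = e (e x * y) * z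
    simp [he, mul_assoc]
  dv_vd := by
    change ∀ x y z : R, x * e (e y * z) = x * e (y * e z)
    simp [he]
  dv_pp := by
    change ∀ x y z : R, x * e (y * z) = x * e (y * e z)
    simp [he]
  assoc₁ := by
    change ∀ x y z : R, (x * e y) * e z = x * e (y * e z)
    simp [he, mul_assoc]
  assoc₂ := by
    change ∀ x y z : R, (e x * y) * e z = e x * (y * e z)
    simp [mul_assoc]
  assoc₃ := by
    change ∀ x y z : R, e (e x * y) * z = e x * (e y * z)
    simp [he, mul_assoc]
  assoc₁₂ := by
    change ∀ x y z : R, (x * y) * e z = x * (y * e z)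
    simp [mul_assoc]
  assoc₁₃ := by
    change ∀ x y z : R, (x * e y) * z = x * (e y * z)
    simp [mul_assoc]
  assoc₂₃ := by
    change ∀ x y z : R, (e x * y) * z = e x * (y * z)
    simp [mul_assoc]
  assoc₁₂₃ := by
    change ∀ x y z : R, (x * y) * z = x * (y * z)
    simp [mul_assoc]

end TwistedTriAlgebra

/-! ### The semidirect sum of `L_⊥` and `L̄`, and the homomorphism `F` -/

section TriLie

attribute [local instance 100] LieRing.ofAssociativeRing

local notation "𝒰" => UniversalEnvelopingAlgebra

variable (k : Type u) (L : Type v) [CommRing k] [AddCommGroup L] [Module k L] [TriAlgebra k L]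
  [IsTriLie k L]

/-- In the right argument of `⊣` the three brackets are interchangeable, so their differences act by
zero. -/
theorem dv_eq_zero_of_mem_L0 (b a : L) (ha : a ∈ L0 k L) : dv k b a = 0 := by
  refine (Submodule.span_le (p := LinearMap.ker (TriAlgebra.op (k := k) TriOp.dashv b))).2 ?_ ha
  rintro x ⟨s, t, a, c, rfl⟩
  rw [SetLike.mem_coe, LinearMap.mem_ker, map_sub, sub_eq_zero]
  exact (dv_op_eq k L s a c b).trans (dv_op_eq k L t a c b).symm

/-- This is the derivation identity for `[· ⊣ z]` on `[· ⊥ ·]` with the sign of `[z ⊢ ·]` absorbed,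
in the form required by `LieDerivation`. -/
theorem vd_pp_eq (z a b : L) :
    vd k z (pp k a b) = pp k a (vd k z b) - pp k b (vd k z a) := by
  have h := IsTriLie.pp_dv (k := k) (L := L) a b z
  rw [IsTriLie.vd_eq, IsTriLie.vd_eq, IsTriLie.vd_eq]
  simp only [pp, dv, map_neg] at h ⊢
  rw [h]
  abel

theorem vd_eq_zero_of_mem_L0 (z x : L) (hz : z ∈ L0 k L) : vd k z x = 0 := by
  rw [IsTriLie.vd_eq, dv_eq_zero_of_mem_L0 k L x z hz, neg_zero]

/-- The Leibniz identity, read as saying that `z ↦ [z ⊢ ·]` turns brackets into commutators; this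
makes the action of `L̄` a Lie homomorphism. -/
theorem dv_vd_eq (y w x : L) :
    vd k (dv k y w) x = vd k y (vd k w x) - vd k w (vd k y x) := by
  have h := IsTriLie.dv_leibniz (k := k) (L := L) x y w
  simp only [IsTriLie.vd_eq]
  simp only [dv, map_neg, LinearMap.neg_apply] at h ⊢
  rw [h]
  abel

/-- The identity map, as a linear equivalence. -/
def toLPerp : L ≃ₗ[k] LPerp k L := LinearEquiv.refl k L

/-- The derivation `x ↦ [z ⊢ x]` of `L_⊥`. -/
def LPerp.der (z : L) : LieDerivation k (LPerp k L) (LPerp k L) where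
  toLinearMap := (TriAlgebra.op (k := k) (A := L) TriOp.vdash z : L →ₗ[k] L)
  leibniz' a b := vd_pp_eq k L z a b

/-- The action of `L̄` on `L_⊥` by derivations. -/
def LBar.action : LBar k L →ₗ⁅k⁆ LieDerivation k (LPerp k L) (LPerp k L) where
  toLinearMap := (L0 k L).liftQ
    { toFun := LPerp.der k L
      map_add' := fun a b => LieDerivation.ext fun x =>
        LinearMap.map_add₂ (TriAlgebra.op (k := k) (A := L) TriOp.vdash) a b x
      map_smul' := fun c a => LieDerivation.ext fun x =>
        LinearMap.map_smul₂ (TriAlgebra.op (k := k) (A := L) TriOp.vdash) c a x }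
    -- The action descends to `L̄` because `[z ⊢ ·] = -[· ⊣ z]` vanishes for `z` in `L₀`.
    (fun z hz => LieDerivation.ext fun x => vd_eq_zero_of_mem_L0 k L z x hz)
  map_lie' {y w} := by
    obtain ⟨y, rfl⟩ := LBar.mk_surjective k L y
    obtain ⟨w, rfl⟩ := LBar.mk_surjective k L w
    rw [LBar.bracket_mk k L TriOp.dashv]
    refine LieDerivation.ext fun x => ?_
    rw [LieDerivation.commutator_apply]
    exact dv_vd_eq k L y w x

theorem LBar.action_mk (z x : L) :
    LBar.action k L (LBar.mk k L z) (toLPerp k L x) = toLPerp k L (vd k z x) := rfl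

/-- The semidirect sum `L_⊥ ⋊ L̄`. -/
abbrev SemiSum : Type v := SemiDirectSum (LPerp k L) (LBar k L) (LBar.action k L)

/-- The projection `L_⊥ → L̄`. -/
def LPerp.toBar : LPerp k L →ₗ⁅k⁆ LBar k L where
  toLinearMap := LBar.mk k L
  map_lie' {x y} := (LBar.bracket_mk k L TriOp.perp x y).symm

/-- The homomorphism `L_⊥ ⋊ L̄ → L̄`, `(x, y) ↦ x̄ + y`. -/
def SemiSum.toBar : SemiSum k L →ₗ⁅k⁆ LBar k L :=
  semiDirectLift (LBar.action k L) (LPerp.toBar k L) LieHom.id fun y x => by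
    obtain ⟨z, rfl⟩ := LBar.mk_surjective k L y
    exact (LBar.bracket_mk k L TriOp.vdash z x).symm

/-- An element of `L` as an element of `U(L_⊥ ⋊ L̄)`. -/
noncomputable def SemiSum.ofPerp (x : L) : 𝒰 k (SemiSum k L) :=
  UniversalEnvelopingAlgebra.ι k (SemiDirectSum.inl (LBar.action k L) (toLPerp k L x))

/-- The algebra homomorphism `U(L_⊥ ⋊ L̄) → U(L̄)` extending `(x, y) ↦ x̄ + y`. -/
noncomputable def SemiSum.retract : 𝒰 k (SemiSum k L) →ₐ[k] 𝒰 k (LBar k L) :=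
  UEA.map (SemiSum.toBar k L)

/-- The inclusion `U(L̄) → U(L_⊥ ⋊ L̄)`. -/
noncomputable def SemiSum.incl : 𝒰 k (LBar k L) →ₐ[k] 𝒰 k (SemiSum k L) :=
  UEA.map (SemiDirectSum.inr (LBar.action k L))

/-- The algebra homomorphism `U(L_⊥ ⋊ L̄) → U(L̄)` extending `(x, y) ↦ y`. -/
noncomputable def SemiSum.proj : 𝒰 k (SemiSum k L) →ₐ[k] 𝒰 k (LBar k L) :=
  UEA.map (SemiDirectSum.projr (LBar.action k L))

variable {L}

theorem SemiSum.retract_ofPerp (x : L) : SemiSum.retract k L (SemiSum.ofPerp k L x)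
    = UniversalEnvelopingAlgebra.ι k (LBar.mk k L x) := by
  rw [SemiSum.retract, SemiSum.ofPerp, UEA.map_ι, SemiSum.toBar, semiDirectLift_inl]
  rfl

theorem SemiSum.proj_ofPerp (x : L) : SemiSum.proj k L (SemiSum.ofPerp k L x) = 0 := by
  rw [SemiSum.proj, SemiSum.ofPerp, UEA.map_ι, SemiDirectSum.projr_inl_apply, map_zero]

theorem SemiSum.incl_ι (y : LBar k L) : SemiSum.incl k L (UniversalEnvelopingAlgebra.ι k y)
    = UniversalEnvelopingAlgebra.ι k (SemiDirectSum.inr (LBar.action k L) y) :=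
  UEA.map_ι _ y

theorem SemiSum.retract_incl (a : 𝒰 k (LBar k L)) :
    SemiSum.retract k L (SemiSum.incl k L a) = a := by
  induction a using UEA.induction with
  | algebraMap c => rw [AlgHom.commutes, AlgHom.commutes]
  | ι x =>
    rw [SemiSum.incl_ι, SemiSum.retract, UEA.map_ι, SemiSum.toBar, semiDirectLift_inr]
    rfl
  | add a b ha hb => rw [map_add, map_add, ha, hb]
  | mul a b ha hb => rw [map_mul, map_mul, ha, hb]

/-- The bracket `[a ⊢ b]` is the action of `ā` on `b`, which the semidirect sum turns into a
commutator. -/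
theorem SemiSum.ofPerp_op_vd (a b : L) : SemiSum.ofPerp k L (vd k a b) =
    SemiSum.incl k L (UniversalEnvelopingAlgebra.ι k (LBar.mk k L a)) * SemiSum.ofPerp k L b
    - SemiSum.ofPerp k L b * SemiSum.incl k L (UniversalEnvelopingAlgebra.ι k (LBar.mk k L a)) := by
  have h := SemiDirectSum.inl_apply_eq_lie (LBar.action k L) (LBar.mk k L a) (toLPerp k L b)
  rw [LBar.action_mk] at h
  rw [SemiSum.incl_ι, SemiSum.ofPerp, h, UEA.ι_lie, SemiSum.ofPerp]

theorem SemiSum.ofPerp_op_pp (a b : L) : SemiSum.ofPerp k L (pp k a b) =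
    SemiSum.ofPerp k L a * SemiSum.ofPerp k L b - SemiSum.ofPerp k L b * SemiSum.ofPerp k L a := by
  have h : SemiDirectSum.inl (LBar.action k L) (toLPerp k L (pp k a b))
      = ⁅SemiDirectSum.inl (LBar.action k L) (toLPerp k L a),
        SemiDirectSum.inl (LBar.action k L) (toLPerp k L b)⁆ :=
    LieHom.map_lie (SemiDirectSum.inl (LBar.action k L)) (toLPerp k L a) (toLPerp k L b)
  rw [SemiSum.ofPerp, h, UEA.ι_lie, SemiSum.ofPerp, SemiSum.ofPerp]

variable (L)

/-- A linear map to `U(L_⊥ ⋊ L̄)` that is a homomorphism for the operations given by the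
retraction to `U(L̄)`. -/
structure IsSemiSumHom (F : TriUEA k L →ₗ[k] 𝒰 k (SemiSum k L)) : Prop where
  map_vd : ∀ a b, F (vd k a b) = SemiSum.incl k L (SemiSum.retract k L (F a)) * F b
  map_dv : ∀ a b, F (dv k a b) = F a * SemiSum.incl k L (SemiSum.retract k L (F b))
  map_pp : ∀ a b, F (pp k a b) = F a * F b
  map_gen : ∀ x, F (TriUEA.mk k L (gen k x)) = SemiSum.ofPerp k L x

/-- Since `e` sends `(a, 0)` to `(0, ā)`, the twisted commutator for `⊢` of `(a, 0)` and `(b, 0)` is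
the commutator of `ā` and `b` in `R`, that is, `[a ⊢ b]`. The embedding of `L_⊥` thus respects the
brackets, and the universal property applies. -/
theorem exists_isSemiSumHom : ∃ F, IsSemiSumHom k L F := by
  let e := (SemiSum.incl k L).comp (SemiSum.retract k L)
  have he : ∀ a, e (e a) = e a := fun a =>
    -- Idempotence of `e`: the retraction splits the inclusion.
    congrArg (SemiSum.incl k L) (SemiSum.retract_incl k _)
  have := twisted_isTriAs e he
  let ψ : L →ₗ[k] Minus k (Twisted e) :=
    { toFun := SemiSum.ofPerp k L
      map_add' := fun x y => ((UniversalEnvelopingAlgebra.ι k).toLinearMap ∘ₗ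
        (SemiDirectSum.inl (LBar.action k L)).toLinearMap).map_add x y
      map_smul' := fun c x => ((UniversalEnvelopingAlgebra.ι k).toLinearMap ∘ₗ
        (SemiDirectSum.inl (LBar.action k L)).toLinearMap).map_smul c x }
  have hvd : ∀ a b, ψ (vd k a b) = vd k (ψ a) (ψ b) := fun a b => by
    change SemiSum.ofPerp k L (vd k a b) =
      SemiSum.incl k L (SemiSum.retract k L (SemiSum.ofPerp k L a)) * SemiSum.ofPerp k L b
      - SemiSum.ofPerp k L b * SemiSum.incl k L (SemiSum.retract k L (SemiSum.ofPerp k L a))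
    rw [SemiSum.retract_ofPerp, SemiSum.ofPerp_op_vd]
  have hψ : IsTriHom ψ := by
    rintro (_ | _ | _) a b
    · exact hvd a b
    · have h : dv k a b = - vd k b a := by rw [IsTriLie.vd_eq, neg_neg]
      change ψ (dv k a b) = dv k (ψ a) (ψ b)
      rw [h, map_neg, hvd, IsTriLie.vd_eq, neg_neg]
    · exact SemiSum.ofPerp_op_pp k a b
  obtain ⟨ξ, ⟨hξ, hι⟩, -⟩ := TriUEA.existsUnique_lift (Twisted e) ψ hψ
  exact ⟨ξ, hξ TriOp.vdash, hξ TriOp.dashv, hξ TriOp.perp, hι⟩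

end TriLie

/-! ### Left and right actions of `L̄` on the tri-associative envelope -/

section TriUEAModules

attribute [local instance 100] LieRing.ofAssociativeRing

local notation "𝒰" => UniversalEnvelopingAlgebra

variable (k : Type u) (L : Type v) [CommRing k] [AddCommGroup L] [Module k L] [TriAlgebra k L]

/-- Induction over monomials. -/
theorem TriUEA.induction {P : TriUEA k L → Prop} (zero : P 0) (add : ∀ a b, P a → P b → P (a + b))
    (smul : ∀ (c : k) a, P a → P (c • a)) (gen : ∀ x, P (TriUEA.mk k L (gen k x)))
    (op : ∀ s a b, P a → P b → P (TriAlgebra.op (k := k) s a b)) (a : TriUEA k L) : P a := by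
  obtain ⟨a, rfl⟩ := TriUEA.mk_surjective k L a
  induction a using Finsupp.induction_linear with
  | zero => rw [map_zero]; exact zero
  | add a b ha hb => rw [map_add]; exact add _ _ ha hb
  | single t c =>
    rw [← mul_one c, ← smul_eq_mul, ← Finsupp.smul_single, map_smul]
    refine smul c _ ?_
    induction t with
    | of x => exact gen x
    | node s p q hp hq =>
      rw [← free_op_single, ← TriUEA.mk_op]
      exact op s _ _ hp hq

/-- The generators of the enveloping algebra. -/
noncomputable def TriUEA.gen : L →ₗ[k] TriUEA k L :=
  (toMinus k (TriUEA k L)).symm.toLinearMap ∘ₗ TriUEA.ι k L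

variable {L}

theorem TriUEA.gen_vd (a b : L) : TriUEA.gen k L (vd k a b) =
    vd k (TriUEA.gen k L a) (TriUEA.gen k L b) - dv k (TriUEA.gen k L b) (TriUEA.gen k L a) :=
  TriUEA.ι_isTriHom k L TriOp.vdash a b

theorem TriUEA.gen_pp (a b : L) : TriUEA.gen k L (pp k a b) =
    pp k (TriUEA.gen k L a) (TriUEA.gen k L b) - pp k (TriUEA.gen k L b) (TriUEA.gen k L a) :=
  TriUEA.ι_isTriHom k L TriOp.perp a b

theorem TriUEA.gen_op (s : TriOp) (a b : L) : ∃ t t' : TriOp,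
    TriUEA.gen k L (TriAlgebra.op (k := k) s a b) =
      TriAlgebra.op (k := k) t (TriUEA.gen k L a) (TriUEA.gen k L b)
      - TriAlgebra.op (k := k) t' (TriUEA.gen k L b) (TriUEA.gen k L a) := by
  cases s with
  | vdash => exact ⟨TriOp.vdash, TriOp.dashv, TriUEA.gen_vd k a b⟩
  | dashv => exact ⟨TriOp.dashv, TriOp.vdash, TriUEA.ι_isTriHom k L TriOp.dashv a b⟩
  | perp => exact ⟨TriOp.perp, TriOp.perp, TriUEA.gen_pp k a b⟩

section

variable {A : Type w} [AddCommGroup A] [Module k A] [TriAlgebra k A] [IsTriAs k A]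

/-- Left multiplication by `⊢` does not see which operation formed its non-emphasized factor. With
`dv_op` this lets the one-sided actions factor through `L̄`. -/
theorem vd_op (s : TriOp) (a b c : A) :
    vd k (TriAlgebra.op (k := k) s a b) c = vd k a (vd k b c) := by
  cases s with
  | vdash => exact IsTriAs.assoc₃ a b c
  | dashv => exact (IsTriAs.vd_dv a b c).trans (IsTriAs.assoc₃ a b c)
  | perp => exact (IsTriAs.vd_pp a b c).trans (IsTriAs.assoc₃ a b c)

theorem dv_op (s : TriOp) (a b c : A) :
    dv k c (TriAlgebra.op (k := k) s a b) = dv k (dv k c a) b := by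
  cases s with
  | vdash => exact (IsTriAs.dv_vd c a b).trans (IsTriAs.assoc₁ c a b).symm
  | dashv => exact (IsTriAs.assoc₁ c a b).symm
  | perp => exact (IsTriAs.dv_pp c a b).trans (IsTriAs.assoc₁ c a b).symm

end

/-- The right side does not depend on `s`: hence `L₀` acts by zero, and the induced action respects
the bracket of `L̄`. -/
theorem TriUEA.vd_gen_op (s : TriOp) (a b : L) (c : TriUEA k L) :
    vd k (TriUEA.gen k L (TriAlgebra.op (k := k) s a b)) c =
      vd k (TriUEA.gen k L a) (vd k (TriUEA.gen k L b) c)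
      - vd k (TriUEA.gen k L b) (vd k (TriUEA.gen k L a) c) := by
  obtain ⟨t, t', h⟩ := TriUEA.gen_op k s a b
  rw [h, ← vd_op k t, ← vd_op k t']
  simp only [vd, map_sub, LinearMap.sub_apply]

theorem TriUEA.dv_gen_op (s : TriOp) (a b : L) (c : TriUEA k L) :
    dv k c (TriUEA.gen k L (TriAlgebra.op (k := k) s a b)) =
      dv k (dv k c (TriUEA.gen k L a)) (TriUEA.gen k L b)
      - dv k (dv k c (TriUEA.gen k L b)) (TriUEA.gen k L a) := by
  obtain ⟨t, t', h⟩ := TriUEA.gen_op k s a b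
  rw [h, ← dv_op k t, ← dv_op k t']
  simp only [dv, map_sub]

variable (L) [IsTriLie k L]

/-- The left action `a ↦ x ⊢ a` of `L̄` on the enveloping algebra. -/
noncomputable def TriUEA.leftAction : LBar k L →ₗ⁅k⁆ Module.End k (TriUEA k L) where
  toLinearMap := (L0 k L).liftQ
    ((TriAlgebra.op (k := k) (A := TriUEA k L) TriOp.vdash) ∘ₗ TriUEA.gen k L)
    (Submodule.span_le.2 <| by
      rintro _ ⟨s, t, a, b, rfl⟩
      rw [SetLike.mem_coe, LinearMap.mem_ker, map_sub, sub_eq_zero]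
      ext c
      exact (TriUEA.vd_gen_op k s a b c).trans (TriUEA.vd_gen_op k t a b c).symm)
  map_lie' {y z} := by
    obtain ⟨y, rfl⟩ := LBar.mk_surjective k L y
    obtain ⟨z, rfl⟩ := LBar.mk_surjective k L z
    rw [LBar.bracket_mk k L TriOp.perp]
    ext c
    exact TriUEA.vd_gen_op k TriOp.perp y z c

/-- The right action `a ↦ a ⊣ x` of `L̄` on the enveloping algebra. -/
noncomputable def TriUEA.rightAction : LBar k L →ₗ⁅k⁆ (Module.End k (TriUEA k L))ᵐᵒᵖ where
  -- A right action reverses composition, so the target is the opposite of the endomorphism algebra.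
  toLinearMap := (MulOpposite.opLinearEquiv k).toLinearMap ∘ₗ (L0 k L).liftQ
    ((TriAlgebra.op (k := k) (A := TriUEA k L) TriOp.dashv).flip ∘ₗ TriUEA.gen k L)
    (Submodule.span_le.2 <| by
      rintro _ ⟨s, t, a, b, rfl⟩
      rw [SetLike.mem_coe, LinearMap.mem_ker, map_sub, sub_eq_zero]
      ext c
      exact (TriUEA.dv_gen_op k s a b c).trans (TriUEA.dv_gen_op k t a b c).symm)
  map_lie' {y z} := by
    obtain ⟨y, rfl⟩ := LBar.mk_surjective k L y
    obtain ⟨z, rfl⟩ := LBar.mk_surjective k L z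
    rw [LBar.bracket_mk k L TriOp.perp]
    apply MulOpposite.unop_injective
    ext c
    exact TriUEA.dv_gen_op k TriOp.perp y z c

/-- The right action of `U(L̄)` on the enveloping algebra, as a bilinear map. -/
noncomputable def TriUEA.act : 𝒰 k (LBar k L) →ₗ[k] Module.End k (TriUEA k L) :=
  (MulOpposite.opLinearEquiv k).symm.toLinearMap ∘ₗ
    (UniversalEnvelopingAlgebra.lift k (TriUEA.rightAction k L)).toLinearMap

variable {L}

theorem TriUEA.act_ι_mk (x : L) (a : TriUEA k L) :
    TriUEA.act k L (UniversalEnvelopingAlgebra.ι k (LBar.mk k L x)) a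
      = dv k a (TriUEA.gen k L x) := by
  change (UniversalEnvelopingAlgebra.lift k (TriUEA.rightAction k L)
    (UniversalEnvelopingAlgebra.ι k (LBar.mk k L x))).unop a = _
  rw [UniversalEnvelopingAlgebra.lift_ι_apply]
  rfl

theorem TriUEA.act_mul (v w : 𝒰 k (LBar k L)) (a : TriUEA k L) :
    TriUEA.act k L (v * w) a = TriUEA.act k L w (TriUEA.act k L v a) := by
  change (UniversalEnvelopingAlgebra.lift k (TriUEA.rightAction k L) (v * w)).unop a = _
  rw [map_mul]
  rfl

theorem TriUEA.act_algebraMap (c : k) (a : TriUEA k L) :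
    TriUEA.act k L (algebraMap k _ c) a = c • a := by
  change (UniversalEnvelopingAlgebra.lift k (TriUEA.rightAction k L) (algebraMap k _ c)).unop a = _
  rw [AlgHom.commutes]
  rfl

/-- Commuting with the right action of the generators implies commuting with all of `U(L̄)`. It is
used for the left multiplications `a ⊢ ·` and `a ⊥ ·`. -/
theorem TriUEA.act_comm (f : Module.End k (TriUEA k L))
    (hf : ∀ (x : L) a, dv k (f a) (TriUEA.gen k L x) = f (dv k a (TriUEA.gen k L x)))
    (v : 𝒰 k (LBar k L)) (a : TriUEA k L) : TriUEA.act k L v (f a) = f (TriUEA.act k L v a) := by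
  induction v using UEA.induction generalizing a with
  | algebraMap c => rw [TriUEA.act_algebraMap, TriUEA.act_algebraMap, map_smul]
  | ι x =>
    obtain ⟨x, rfl⟩ := LBar.mk_surjective k L x
    rw [TriUEA.act_ι_mk, TriUEA.act_ι_mk, hf]
  | add v w hv hw => rw [map_add, LinearMap.add_apply, hv, hw, LinearMap.add_apply, map_add]
  | mul v w hv hw => rw [TriUEA.act_mul, TriUEA.act_mul, hv, hw]

theorem TriUEA.act_vd (v : 𝒰 k (LBar k L)) (a b : TriUEA k L) :
    TriUEA.act k L v (vd k a b) = vd k a (TriUEA.act k L v b) :=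
  TriUEA.act_comm k (TriAlgebra.op (k := k) TriOp.vdash a)
    (fun x b => IsTriAs.assoc₂ a b (TriUEA.gen k L x)) v b

theorem TriUEA.act_pp (v : 𝒰 k (LBar k L)) (a b : TriUEA k L) :
    TriUEA.act k L v (pp k a b) = pp k a (TriUEA.act k L v b) :=
  TriUEA.act_comm k (TriAlgebra.op (k := k) TriOp.perp a)
    (fun x b => IsTriAs.assoc₁₂ a b (TriUEA.gen k L x)) v b

/-! ### The model `TriUEA k L × U(L̄)` of the left regular module -/

variable (L)

/-- The action of `L_⊥` on the sum of the enveloping algebra and `U(L̄)`. -/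
noncomputable def TriUEA.perpAction :
    LPerp k L →ₗ⁅k⁆ Module.End k (TriUEA k L × 𝒰 k (LBar k L)) where
  toLinearMap :=
    -- The operator is `(a, v) ↦ (x ⊥ a + x · v, 0)`. Under the expected identification of `(a, v)`
    -- with `F a + v` it is left multiplication by `x`, whose values lie in the image of `F`.
    { toFun := fun x => LinearMap.inl k _ _ ∘ₗ LinearMap.coprod
        (TriAlgebra.op (k := k) TriOp.perp (TriUEA.gen k L ((toLPerp k L).symm x)))
        ((TriUEA.act k L).flip (TriUEA.gen k L ((toLPerp k L).symm x)))
      map_add' := fun x y => by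
        ext <;> simp
      map_smul' := fun c x => by
        ext <;> simp }
  map_lie' {x y} := by
    obtain ⟨x, rfl⟩ := (toLPerp k L).surjective x
    obtain ⟨y, rfl⟩ := (toLPerp k L).surjective y
    rw [LieRing.of_associative_ring_bracket]
    refine LinearMap.ext fun ⟨a, v⟩ => ?_
    have h1 : pp k (TriUEA.gen k L (pp k x y)) a + TriUEA.act k L v (TriUEA.gen k L (pp k x y)) =
        (pp k (TriUEA.gen k L x) (pp k (TriUEA.gen k L y) a
            + TriUEA.act k L v (TriUEA.gen k L y)) + TriUEA.act k L 0 (TriUEA.gen k L x))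
        - (pp k (TriUEA.gen k L y) (pp k (TriUEA.gen k L x) a
            + TriUEA.act k L v (TriUEA.gen k L x)) + TriUEA.act k L 0 (TriUEA.gen k L y)) := by
      have h2 := IsTriAs.assoc₁₂₃ (k := k) (A := TriUEA k L)
      have h3 := TriUEA.act_pp k v (L := L)
      rw [TriUEA.gen_pp]
      simp only [pp, map_add, map_sub, map_zero, LinearMap.zero_apply, LinearMap.sub_apply]
        at h2 h3 ⊢
      rw [h2, h2, h3, h3]
      abel
    exact Prod.ext h1 (sub_zero (0 : 𝒰 k (LBar k L))).symm

/-- The action of `L̄` on the sum of the enveloping algebra and `U(L̄)`. -/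
noncomputable def TriUEA.barAction :
    LBar k L →ₗ⁅k⁆ Module.End k (TriUEA k L × 𝒰 k (LBar k L)) where
  toLinearMap :=
    { toFun := fun y => (TriUEA.leftAction k L y).prodMap (UEA.mulLeft k _ y)
      map_add' := fun x y => by
        rw [map_add, map_add]; rfl
      map_smul' := fun c x => by
        rw [map_smul, map_smul]; rfl }
  map_lie' {x y} := by
    change (TriUEA.leftAction k L ⁅x, y⁆).prodMap (UEA.mulLeft k _ ⁅x, y⁆) = _
    rw [LieHom.map_lie, LieHom.map_lie]
    rfl

/-- The compatibility that joins the two actions into one of the semidirect sum. After expanding `[z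
⊢ x] = z ⊢ x - x ⊣ z`, it reduces to `(z ⊢ x) ⊥ a = z ⊢ (x ⊥ a)`, `(x ⊣ z) ⊥ a = x ⊥ (z ⊢ a)` and
the commutation of `z ⊢ ·` with the right action. -/
theorem TriUEA.perpAction_action (y : LBar k L) (x : LPerp k L) :
    TriUEA.perpAction k L (LBar.action k L y x)
      = ⁅TriUEA.barAction k L y, TriUEA.perpAction k L x⁆ := by
  obtain ⟨z, rfl⟩ := LBar.mk_surjective k L y
  obtain ⟨x, rfl⟩ := (toLPerp k L).surjective x
  rw [LieRing.of_associative_ring_bracket]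
  refine LinearMap.ext fun ⟨a, v⟩ => ?_
  have h1 : pp k (TriUEA.gen k L (vd k z x)) a + TriUEA.act k L v (TriUEA.gen k L (vd k z x)) =
      vd k (TriUEA.gen k L z) (pp k (TriUEA.gen k L x) a + TriUEA.act k L v (TriUEA.gen k L x))
      - (pp k (TriUEA.gen k L x) (vd k (TriUEA.gen k L z) a) +
        TriUEA.act k L (UniversalEnvelopingAlgebra.ι k (LBar.mk k L z) * v)
          (TriUEA.gen k L x)) := by
    rw [TriUEA.act_mul, TriUEA.act_ι_mk, TriUEA.gen_vd]
    have h2 := IsTriAs.assoc₂₃ (k := k) (A := TriUEA k L)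
    have h3 := IsTriAs.assoc₁₃ (k := k) (A := TriUEA k L)
    have h4 := TriUEA.act_vd k v (L := L)
    simp only [pp, vd, dv, map_add, map_sub, LinearMap.sub_apply] at h2 h3 h4 ⊢
    rw [h2, h3, h4]
    abel
  have h2 : (0 : 𝒰 k (LBar k L)) = UniversalEnvelopingAlgebra.ι k (LBar.mk k L z) * 0 - 0 := by
    rw [mul_zero, sub_zero]
  exact Prod.ext h1 h2

/-- The action of `U(L_⊥ ⋊ L̄)` on the sum of the enveloping algebra and `U(L̄)`. -/
noncomputable def TriUEA.semiAction :
    𝒰 k (SemiSum k L) →ₐ[k] Module.End k (TriUEA k L × 𝒰 k (LBar k L)) :=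
  UniversalEnvelopingAlgebra.lift k <| semiDirectLift (LBar.action k L) (TriUEA.perpAction k L)
    (TriUEA.barAction k L) (TriUEA.perpAction_action k L)

variable {L}

theorem TriUEA.semiAction_ofPerp (x : L) (p : TriUEA k L × 𝒰 k (LBar k L)) :
    TriUEA.semiAction k L (SemiSum.ofPerp k L x) p =
      (pp k (TriUEA.gen k L x) p.1 + TriUEA.act k L p.2 (TriUEA.gen k L x), 0) := by
  rw [TriUEA.semiAction, SemiSum.ofPerp, UniversalEnvelopingAlgebra.lift_ι_apply,
    semiDirectLift_inl]
  rfl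

theorem TriUEA.semiAction_incl_ι (x : L) (p : TriUEA k L × 𝒰 k (LBar k L)) :
    TriUEA.semiAction k L (SemiSum.incl k L
        (UniversalEnvelopingAlgebra.ι k (LBar.mk k L x))) p =
      (vd k (TriUEA.gen k L x) p.1, UniversalEnvelopingAlgebra.ι k (LBar.mk k L x) * p.2) := by
  rw [TriUEA.semiAction, SemiSum.incl_ι, UniversalEnvelopingAlgebra.lift_ι_apply,
    semiDirectLift_inr]
  rfl

/-! ### Injectivity and image of `F` -/

variable {k}

/-- The twist `e` becomes invisible after retraction, so all three operations turn into the product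
of `U(L̄)`. -/
theorem IsSemiSumHom.retract_op {F : TriUEA k L →ₗ[k] 𝒰 k (SemiSum k L)}
    (hF : IsSemiSumHom k L F) (s : TriOp) (a b : TriUEA k L) :
    SemiSum.retract k L (F (TriAlgebra.op (k := k) s a b))
      = SemiSum.retract k L (F a) * SemiSum.retract k L (F b) := by
  cases s with
  | vdash => exact (congrArg _ (hF.map_vd a b)).trans (by rw [map_mul, SemiSum.retract_incl])
  | dashv => exact (congrArg _ (hF.map_dv a b)).trans (by rw [map_mul, SemiSum.retract_incl])
  | perp => exact (congrArg _ (hF.map_pp a b)).trans (map_mul _ _ _)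

/-- Right action through the retraction recovers `⊣` for arbitrary elements: both sides are
multiplicative in the non-emphasized factor `a`, and they agree on generators. -/
theorem IsSemiSumHom.act_retract {F : TriUEA k L →ₗ[k] 𝒰 k (SemiSum k L)}
    (hF : IsSemiSumHom k L F) (a b : TriUEA k L) :
    TriUEA.act k L (SemiSum.retract k L (F a)) b = dv k b a := by
  induction a using TriUEA.induction generalizing b with
  | zero => simp only [map_zero, LinearMap.zero_apply, dv]
  | add a a' ha ha' => simp only [map_add, LinearMap.add_apply, ha, ha', dv]
  | smul c a ha => simp only [map_smul, LinearMap.smul_apply, ha, dv]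
  | gen x =>
    rw [hF.map_gen, SemiSum.retract_ofPerp, TriUEA.act_ι_mk]
    rfl
  | op s a a' ha ha' => rw [hF.retract_op, TriUEA.act_mul, ha, ha', dv_op]

theorem IsSemiSumHom.semiAction_incl_retract {F : TriUEA k L →ₗ[k] 𝒰 k (SemiSum k L)}
    (hF : IsSemiSumHom k L F) (a : TriUEA k L) (p : TriUEA k L × 𝒰 k (LBar k L)) :
    TriUEA.semiAction k L (SemiSum.incl k L (SemiSum.retract k L (F a))) p
      = (vd k a p.1, SemiSum.retract k L (F a) * p.2) := by
  induction a using TriUEA.induction generalizing p with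
  | zero => simp only [map_zero, LinearMap.zero_apply, vd, zero_mul]; rfl
  | add a a' ha ha' => simp only [map_add, LinearMap.add_apply, ha, ha', vd, add_mul]; rfl
  | smul c a ha => simp only [map_smul, LinearMap.smul_apply, ha, vd, smul_mul_assoc]; rfl
  | gen x =>
    rw [hF.map_gen, SemiSum.retract_ofPerp, TriUEA.semiAction_incl_ι]
    rfl
  | op s a a' ha ha' =>
    rw [hF.retract_op, map_mul, map_mul, Module.End.mul_apply, ha', ha, vd_op, mul_assoc]

/-- The formula known for generators propagates through each operation: `⊢` and `⊣` use the action
of the twisted factor from `IsSemiSumHom.semiAction_incl_retract`, `⊥` composes two operators of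
this form, and the tri-associative identities close the induction. -/
theorem IsSemiSumHom.semiAction_apply {F : TriUEA k L →ₗ[k] 𝒰 k (SemiSum k L)}
    (hF : IsSemiSumHom k L F) (a : TriUEA k L) (p : TriUEA k L × 𝒰 k (LBar k L)) :
    TriUEA.semiAction k L (F a) p = (pp k a p.1 + TriUEA.act k L p.2 a, 0) := by
  induction a using TriUEA.induction generalizing p with
  | zero => simp only [map_zero, LinearMap.zero_apply, pp, add_zero]; rfl
  | add a a' ha ha' =>
    simp only [map_add, LinearMap.add_apply, ha, ha', pp, Prod.mk_add_mk, add_zero]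
    rw [add_add_add_comm]
  | smul c a ha =>
    simp only [map_smul, LinearMap.smul_apply, ha, pp, Prod.smul_mk, smul_add, smul_zero]
  | gen x =>
    rw [hF.map_gen, TriUEA.semiAction_ofPerp]
    rfl
  | op s a b ha hb =>
    cases s with
    | vdash =>
      change TriUEA.semiAction k L (F (vd k a b)) p
        = (pp k (vd k a b) p.1 + TriUEA.act k L p.2 (vd k a b), 0)
      rw [hF.map_vd, map_mul, Module.End.mul_apply, hb, hF.semiAction_incl_retract, mul_zero,
        IsTriAs.assoc₂₃, TriUEA.act_vd]
      simp only [vd, map_add]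
    | dashv =>
      change TriUEA.semiAction k L (F (dv k a b)) p
        = (pp k (dv k a b) p.1 + TriUEA.act k L p.2 (dv k a b), 0)
      rw [hF.map_dv, map_mul, Module.End.mul_apply, hF.semiAction_incl_retract, ha,
        IsTriAs.assoc₁₃, TriUEA.act_mul, hF.act_retract]
    | perp =>
      change TriUEA.semiAction k L (F (pp k a b)) p
        = (pp k (pp k a b) p.1 + TriUEA.act k L p.2 (pp k a b), 0)
      rw [hF.map_pp, map_mul, Module.End.mul_apply, hb, ha, map_zero, LinearMap.zero_apply, add_zero,
        IsTriAs.assoc₁₂₃, TriUEA.act_pp]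
      simp only [pp, map_add]

theorem IsSemiSumHom.injective {F : TriUEA k L →ₗ[k] 𝒰 k (SemiSum k L)}
    (hF : IsSemiSumHom k L F) : Function.Injective F := by
  refine (injective_iff_map_eq_zero F).2 fun a ha => ?_
  -- The vector `(0, 1)` stands for the unit of `R`; its image recovers `a`.
  have h := hF.semiAction_apply a (0, 1)
  have h1 : TriUEA.act k L 1 a = a := by simpa using TriUEA.act_algebraMap k 1 a
  rw [ha, map_zero, LinearMap.zero_apply, h1] at h
  simpa [pp] using (congrArg Prod.fst h).symm

/-- The image is a right ideal: right multiplication by `x` in `L_⊥` is `· ⊥ x`, and by `z̄` in `L̄`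
it is `· ⊣ z`, since `e` sends `F` of the generator `z` to `z̄`. -/
theorem IsSemiSumHom.mul_mem_range {F : TriUEA k L →ₗ[k] 𝒰 k (SemiSum k L)}
    (hF : IsSemiSumHom k L F) (u : 𝒰 k (SemiSum k L)) :
    ∀ r ∈ LinearMap.range F, r * u ∈ LinearMap.range F := by
  induction u using UEA.induction with
  | algebraMap c =>
    intro r hr
    rw [← Algebra.commutes, ← Algebra.smul_def]
    exact Submodule.smul_mem _ c hr
  | ι s =>
    rintro _ ⟨a, rfl⟩
    obtain ⟨z, hz⟩ := LBar.mk_surjective k L s.right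
    rw [SemiDirectSum.eq_inl_add_inr _ s, map_add, mul_add]
    refine Submodule.add_mem _ ⟨pp k a (TriUEA.mk k L (gen k ((toLPerp k L).symm s.left))), ?_⟩
      ⟨dv k a (TriUEA.mk k L (gen k z)), ?_⟩
    · rw [hF.map_pp, hF.map_gen]
      rfl
    · rw [hF.map_dv, hF.map_gen, SemiSum.retract_ofPerp, hz, SemiSum.incl_ι]
  | add u v hu hv =>
    intro r hr
    rw [mul_add]
    exact Submodule.add_mem _ (hu r hr) (hv r hr)
  | mul u v hu hv =>
    intro r hr
    rw [← mul_assoc]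
    exact hv _ (hu r hr)

theorem SemiSum.proj_incl (a : 𝒰 k (LBar k L)) :
    SemiSum.proj k L (SemiSum.incl k L a) = a := by
  induction a using UEA.induction with
  | algebraMap c => rw [AlgHom.commutes, AlgHom.commutes]
  | ι x => rw [SemiSum.incl_ι, SemiSum.proj, UEA.map_ι, SemiDirectSum.projr_inr_apply]
  | add a b ha hb => rw [map_add, map_add, ha, hb]
  | mul a b ha hb => rw [map_mul, map_mul, ha, hb]

/-- Every element is its projection plus an element of the image of `F`, by induction on left
factors. A factor from `L_⊥` lands in the right ideal and projects to zero; a factor `z̄` commutes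
with the decomposition and acts on the image as `z ⊢ ·`. -/
theorem IsSemiSumHom.sub_incl_proj_mem_range {F : TriUEA k L →ₗ[k] 𝒰 k (SemiSum k L)}
    (hF : IsSemiSumHom k L F) (u : 𝒰 k (SemiSum k L)) :
    u - SemiSum.incl k L (SemiSum.proj k L u) ∈ LinearMap.range F := by
  refine UEA.semiDirect_induction_left (LBar.action k L) ((LinearMap.range F).comap
    (LinearMap.id - (SemiSum.incl k L).toLinearMap ∘ₗ (SemiSum.proj k L).toLinearMap)) ?_ ?_ ?_ u
  · change 1 - SemiSum.incl k L (SemiSum.proj k L 1) ∈ LinearMap.range F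
    rw [map_one, map_one, sub_self]
    exact zero_mem _
  · intro x a _
    obtain ⟨x, rfl⟩ := (toLPerp k L).surjective x
    change SemiSum.ofPerp k L x * a
      - SemiSum.incl k L (SemiSum.proj k L (SemiSum.ofPerp k L x * a)) ∈ LinearMap.range F
    rw [map_mul, SemiSum.proj_ofPerp, zero_mul, map_zero, sub_zero]
    exact hF.mul_mem_range a _ ⟨_, hF.map_gen x⟩
  · rintro y a ⟨r, hr⟩
    obtain ⟨z, rfl⟩ := LBar.mk_surjective k L y
    rw [← SemiSum.incl_ι]
    change F r = a - SemiSum.incl k L (SemiSum.proj k L a) at hr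
    refine ⟨vd k (TriUEA.mk k L (gen k z)) r, ?_⟩
    change _ = SemiSum.incl k L (UniversalEnvelopingAlgebra.ι k (LBar.mk k L z)) * a
      - SemiSum.incl k L (SemiSum.proj k L
        (SemiSum.incl k L (UniversalEnvelopingAlgebra.ι k (LBar.mk k L z)) * a))
    rw [hF.map_vd, hF.map_gen, SemiSum.retract_ofPerp, hr, map_mul, SemiSum.proj_incl, map_mul, mul_sub]

/-- The projection kills the generators, and each twisted product retains at least one untwisted
factor, so the image lies in the kernel. Conversely, an element of the kernel equals its difference
from its own projection, which is in the image. -/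
theorem IsSemiSumHom.range_eq {F : TriUEA k L →ₗ[k] 𝒰 k (SemiSum k L)}
    (hF : IsSemiSumHom k L F) :
    LinearMap.range F = LinearMap.ker (SemiSum.proj k L).toLinearMap := by
  apply le_antisymm
  · rintro _ ⟨a, rfl⟩
    rw [LinearMap.mem_ker, AlgHom.toLinearMap_apply]
    induction a using TriUEA.induction with
    | zero => rw [map_zero, map_zero]
    | add a b ha hb => rw [map_add, map_add, ha, hb, add_zero]
    | smul c a ha => rw [map_smul, map_smul, ha, smul_zero]
    | gen x => rw [hF.map_gen, SemiSum.proj_ofPerp]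
    | op s a b ha hb =>
      cases s with
      | vdash => exact (congrArg _ (hF.map_vd a b)).trans (by rw [map_mul, hb, mul_zero])
      | dashv => exact (congrArg _ (hF.map_dv a b)).trans (by rw [map_mul, ha, zero_mul])
      | perp => exact (congrArg _ (hF.map_pp a b)).trans (by rw [map_mul, hb, mul_zero])
  · intro u hu
    rw [LinearMap.mem_ker, AlgHom.toLinearMap_apply] at hu
    simpa [hu] using hF.sub_incl_proj_mem_range u

end TriUEAModules
end TriPBW

theorem mainTheorem8 (k : Type u) [Field k] (L : Type v) [AddCommGroup L] [Module k L]
    [TriPBW.TriAlgebra k L] [TriPBW.IsTriLie k L] :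
    TriPBW.IsTriEnvelope.{u, v, w} k L (TriPBW.TriUEA k L) (TriPBW.TriUEA.ι k L) ∧
    Nonempty (TriPBW.TriUEA k L ≃ₗ[k]
      TensorProduct k (UniversalEnvelopingAlgebra k (TriPBW.LBar k L))
        (TriPBW.augIdeal k (TriPBW.LPerp k L))) := by
  refine ⟨TriPBW.TriUEA.isTriEnvelope k L, ?_⟩
  obtain ⟨F, hF⟩ := TriPBW.exists_isSemiSumHom k L
  obtain ⟨e⟩ := TriPBW.UEA.nonempty_ker_map_projr_equiv (TriPBW.LBar.action k L)
  exact ⟨LinearEquiv.ofInjective F hF.injective ≪≫ₗ LinearEquiv.ofEq _ _ hF.range_eq ≪≫ₗ e ≪≫ₗ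
    TensorProduct.comm k _ _⟩
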